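/- Let $\{d_n\}_{n\ge 1}$ be a sequence of positive integers and $\{\mu_n\}_{n\ge 1}$ a non-increasing sequence of positive real numbers. The mixed $(2,2)$-ellipsoid with dimensions $\{d_n\}$ and semi-axes $\{\mu_n\}$ is $$\mathcal E_{2,2}=\Big\{x=(x_1,x_2,\dots),\ x_j\in\mathbb R^{d_j}\ :\ \Big(\sum_{j\ge 1}\frac{\|x_j\|_2^2}{\mu_j^2}\Big)^{1/2}\le 1\Big\},$$ a subset of the space $\ell^2$ of square-summable block sequences with norm $\|x\|_2=(\sum_j\|x_j\|_2^2)^{1/2}$. For $\rho>0$ let $N(\rho)$ be the smallest number of closed $\|\cdot\|_2$-balls of radius $\rho$, with centres in $\ell^2$, that cover $\mathcal E_{2,2}$. Write $\bar d_k=d_1+\dots+d_k$, and let $\log$ be the logarithm to base $2$. There are an absolute constant $C>0$ and numbers $\kappa_k=\kappa_k(\{d_n\},\gamma)$, depending only on $k$, the dimensions and $\gamma$, with $$\kappa_k = 1+O\Big(\frac{\gamma\,k\log(\bar d_k)}{\bar d_k}\Big),\qquad\text{precisely}\qquad |\kappa_k-1|\le C\,\frac{\gamma\,k\log(\bar d_k)}{\bar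 d_k}\quad\text{whenever } k\ge 1,\ \gamma\ge 1,\ d_1,\dots,d_k\ge 9,$$ such that the following holds. Let $\{d_n\}$, $\{\mu_n\}$ be as above, let $\varepsilon\in(0,\mu_1)$, let $\gamma\ge1$ (possibly depending on $\varepsilon$), let $k\ge1$ be such that $\mu_{k+1}\le\varepsilon<\mu_k$, and assume $d_1,\dots,d_k\ge 9$. Put $$\varepsilon_\gamma=\varepsilon\big(1+\bar d_k^{\,-\gamma}\sqrt{k+1}\big).$$ Then $N(\varepsilon_\gamma)$ is finite and $$\prod_{j=1}^k\mu_j^{d_j/\bar d_k}\ \le\ N(\varepsilon_\gamma)^{1/\bar d_k}\,\varepsilon_\gamma\ \le\ \kappa_k\prod_{j=1}^k\mu_j^{d_j/\bar d_k}.$$ -/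

import Mathlib

open scoped NNReal ENNReal

noncomputable section

/-- The space `ℓ²` of square-summable block sequences `(x₁, x₂, …) ∈ ℝ^{d₁} × ℝ^{d₂} × ⋯` with the
norm `‖·‖₂`. Blocks are numbered from `0` in the code: `d j` is the dimension of the
`(j+1)`-st block. -/
abbrev BlockSpace (d : ℕ → ℕ) : Type :=
  lp (fun j : ℕ => EuclideanSpace ℝ (Fin (d j))) 2

/-- The mixed ellipsoid norm `‖x‖_{2,2,μ} = (∑_j (‖x_j‖₂ / μ_j)²)^{1/2}`, with the value `∞` when
the series diverges. -/
def mixedEllipsoidNorm (d : ℕ → ℕ) (μ : ℕ → ℝ) (x : BlockSpace d) : ℝ≥0∞ :=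
  (∑' j : ℕ, ENNReal.ofReal ((‖x j‖ / μ j) ^ 2)) ^ (1 / 2 : ℝ)

/-- The mixed ellipsoid `E_{2,2}` with dimensions `d` and semi-axes `μ`. -/
def mixedEllipsoid (d : ℕ → ℕ) (μ : ℕ → ℝ) : Set (BlockSpace d) :=
  {x | mixedEllipsoidNorm d μ x ≤ 1}

/-- The covering number `N(ρ; E_{2,2}, ‖·‖₂)`: the smallest cardinality (in `ℕ∞`) of a set of
centres in `ℓ²` whose closed `ρ`-balls cover the mixed ellipsoid. -/
def mixedCoveringNumber (d : ℕ → ℕ) (μ : ℕ → ℝ) (ρ : ℝ) : ℕ∞ :=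
  Metric.externalCoveringNumber ρ.toNNReal (mixedEllipsoid d μ)

/-- The total dimension `d₁ + ⋯ + d_k` of the first `k` blocks. -/
def dimBar (d : ℕ → ℕ) (k : ℕ) : ℕ :=
  ∑ j ∈ Finset.range k, d j

/-- The radius `ε_γ = ε (1 + D^{-γ} √(k+1))`, where `D = d₁ + ⋯ + d_k`. -/
def epsGamma (d : ℕ → ℕ) (k : ℕ) (γ ε : ℝ) : ℝ :=
  ε * (1 + (dimBar d k : ℝ) ^ (-γ) * √((k : ℝ) + 1))

/-- The weighted geometric mean `∏_{j ≤ k} μ_j^{d_j / D}`, where `D = d₁ + ⋯ + d_k`. -/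
def semiAxisMean (d : ℕ → ℕ) (μ : ℕ → ℝ) (k : ℕ) : ℝ :=
  ∏ j ∈ Finset.range k, μ j ^ ((d j : ℝ) / (dimBar d k : ℝ))

end

/-! ### Nets from volume, and greedy selection of random centres. -/

section VolumeCovering

open MeasureTheory Metric Module

/-! Write `D = dimBar d k`, `L = relError d k γ`, and `q = ∑_{j ≤ k} (‖x_j‖ / μ_j)²` for a point `x`
of the ellipsoid.

Lower bound: the section by the first `k` blocks is a `D`-dimensional ellipsoid whose volume is that
of the unit ball times `∏ μ_j ^ d_j`. Projecting the centres to these blocks does not increase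
distances, so volumes can be compared (`prod_semiAxes_le_coveringNumber`).

Upper bound: all later semi-axes are at most `ε`, so the tail of `x` has squared norm at most `ε² (1
- q)` (`norm_sub_headEmb_sq_le`). It therefore suffices to cover the head with squared error about
`ε² q`, that is, with an accuracy that improves towards the centre. Since `q` is a sum over blocks,
each block may be treated alone: after rescaling, a unit ball must be covered with error about `s
‖x‖`, where `s = ε / μ_j < 1`, by `s⁻ⁿ` centres up to a polynomial factor (`exists_unitBall_cover`).
This rests on `volume_lens_ge`: if `s² + R² = 1`, a point chosen uniformly in the ball of radius `R`
is within `s` of a given unit vector with probability of order at least `sⁿ / n`. Greedy selection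
(`exists_finset_hitting`) turns this into a cover of a thin annulus, and dilates of that cover fill
the ball down to radius `τ / 8`, where `τ = D ^ (-γ)`.

The polynomial factors and `1 / τ` cost at most `D ^ (10 γ)` per block, hence `1024 ^ L` after the
`D`-th root. This is `1 + O(L)` only for bounded `L`. For `L ≥ 1` a constant factor is affordable,
and a volumetric net repeated on dyadic shells (`exists_ellipsoid_shell_cover`) has only logarithmic
dependence on `1 / τ`. -/

/-- A maximal separated subset is a net, and its cardinality is controlled by volume. -/
theorem exists_finset_net_of_volume {E : Type*} [NormedAddCommGroup E] [NormedSpace ℝ E]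
    [FiniteDimensional ℝ E] [MeasurableSpace E] [BorelSpace E]
    (ν : Measure E) [ν.IsAddHaarMeasure] {K K' : Set E} {r : ℝ} (hr : 0 < r)
    (hfin : ν K' ≠ ∞) (hK : ∀ x ∈ K, ball x (r / 2) ⊆ K') :
    ∃ S : Finset E, (S : Set E) ⊆ K ∧ (∀ x ∈ K, ∃ y ∈ S, dist x y ≤ r) ∧
      (S.card : ℝ) * ((r / 2) ^ finrank ℝ E * ν.real (ball 0 1)) ≤ ν.real K' := by
  classical
  have hv : 0 < ν.real (ball (0 : E) 1) :=
    ENNReal.toReal_pos (measure_ball_pos ν 0 one_pos).ne' measure_ball_lt_top.ne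
  have hb : ∀ x : E, ν.real (ball x (r / 2)) = (r / 2) ^ finrank ℝ E * ν.real (ball 0 1) := by
    intro x
    rw [measureReal_def, Measure.addHaar_ball_of_pos ν x (by positivity), ENNReal.toReal_mul,
      ENNReal.toReal_ofReal (by positivity), measureReal_def]
  set A := (r / 2) ^ finrank ℝ E * ν.real (ball (0 : E) 1) with hA
  have hApos : 0 < A := by positivity
  have key : ∀ S : Finset E, (S : Set E) ⊆ K → (∀ x ∈ S, ∀ y ∈ S, x ≠ y → r < dist x y) →
      (S.card : ℝ) * A ≤ ν.real K' := by
    intro S hS hsep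
    have h1 : ν.real (⋃ x ∈ S, ball x (r / 2)) = ∑ x ∈ S, ν.real (ball x (r / 2)) := by
      refine measureReal_biUnion_finset ?_ (fun _ _ => measurableSet_ball)
        (fun _ _ => measure_ball_lt_top.ne)
      intro x hx y hy hxy
      exact ball_disjoint_ball (by linarith [hsep x hx y hy hxy])
    rw [Finset.sum_congr rfl (fun x _ => hb x), Finset.sum_const, nsmul_eq_mul] at h1
    rw [← h1]
    exact measureReal_mono (Set.iUnion₂_subset fun x hx => hK x (hS hx)) hfin
  let Q : Set ℕ := {n | ∃ S : Finset E, (S : Set E) ⊆ K ∧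
    (∀ x ∈ S, ∀ y ∈ S, x ≠ y → r < dist x y) ∧ S.card = n}
  have hQb : BddAbove Q := by
    refine ⟨⌊ν.real K' / A⌋₊, ?_⟩
    rintro n ⟨S, h1, h2, rfl⟩
    exact Nat.le_floor ((le_div_iff₀ hApos).2 (key S h1 h2))
  have hQn : Q.Nonempty := ⟨0, ∅, by simp⟩
  obtain ⟨S, h1, h2, h3⟩ := Nat.sSup_mem hQn hQb
  refine ⟨S, h1, ?_, key S h1 h2⟩
  intro x hx
  by_contra! hcon
  have hxS : x ∉ S := fun h => by
    have := hcon x h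
    rw [dist_self] at this
    linarith
  have hmem : (insert x S).card ∈ Q := by
    refine ⟨insert x S, ?_, ?_, rfl⟩
    · rw [Finset.coe_insert]
      exact Set.insert_subset hx h1
    · intro a ha b hb hab
      rcases Finset.mem_insert.1 ha with rfl | ha' <;>
        rcases Finset.mem_insert.1 hb with rfl | hb'
      · exact absurd rfl hab
      · exact hcon b hb'
      · rw [dist_comm]; exact hcon a ha'
      · exact h2 a ha' b hb' hab
  have := le_csSup hQb hmem
  rw [Finset.card_insert_of_notMem hxS] at this
  omega

theorem exists_finset_net_closedBall {E : Type*} [NormedAddCommGroup E] [NormedSpace ℝ E]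
    [FiniteDimensional ℝ E] {a r : ℝ} (ha : 0 ≤ a) (hr : 0 < r) {K : Set E}
    (hK : K ⊆ closedBall 0 a) :
    ∃ S : Finset E, (S : Set E) ⊆ K ∧ (∀ x ∈ K, ∃ y ∈ S, dist x y ≤ r) ∧
      (S.card : ℝ) ≤ (1 + 2 * a / r) ^ finrank ℝ E := by
  borelize E
  let ν : Measure E := Measure.addHaar
  obtain ⟨S, h1, h2, h3⟩ := exists_finset_net_of_volume ν (K := K)
    (K' := closedBall (0 : E) (a + r / 2)) hr measure_closedBall_lt_top.ne (by
      intro x hx y hy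
      have := hK hx
      rw [mem_closedBall, dist_zero_right] at this ⊢
      rw [mem_ball] at hy
      calc ‖y‖ = ‖x + (y - x)‖ := by congr 1; abel
        _ ≤ ‖x‖ + ‖y - x‖ := norm_add_le _ _
        _ ≤ a + r / 2 := by rw [← dist_eq_norm]; linarith)
  refine ⟨S, h1, h2, ?_⟩
  have hv : 0 < ν.real (ball (0 : E) 1) :=
    ENNReal.toReal_pos (measure_ball_pos ν 0 one_pos).ne' measure_ball_lt_top.ne
  rw [measureReal_def ν (closedBall _ _), Measure.addHaar_closedBall ν _ (by positivity),
    ENNReal.toReal_mul, ENNReal.toReal_ofReal (by positivity), ← measureReal_def, ← mul_assoc] at h3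
  have h4 := le_of_mul_le_mul_right h3 hv
  have h5 : (1 + 2 * a / r) = (a + r / 2) / (r / 2) := by field_simp; ring
  rw [h5, div_pow]
  exact (le_div_iff₀ (by positivity)).2 h4

/-- If every target set has probability at least `p`, then `n + (1 - p) ^ n * |V|` points suffice
to hit all of them. -/
theorem exists_finset_hitting {Ω ι : Type*} [MeasurableSpace Ω]
    (P : Measure Ω) [IsProbabilityMeasure P] (V : Finset ι) (G : ι → Set Ω)
    (hG : ∀ v ∈ V, MeasurableSet (G v)) {p : ℝ} (hp : 0 < p) (hp1 : p ≤ 1)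
    (hPG : ∀ v ∈ V, p ≤ P.real (G v)) (n : ℕ) :
    ∃ S : Finset Ω, (S.card : ℝ) ≤ n + (1 - p) ^ n * V.card ∧ ∀ v ∈ V, ∃ c ∈ S, c ∈ G v := by
  classical
  -- Averaging: the expected number of targets in `U` hit by a random point is at least `p |U|`, so
  -- some point does at least as well.
  have step : ∀ U ⊆ V, ∃ c : Ω, p * U.card ≤ ((U.filter fun v => c ∈ G v).card : ℝ) := by
    intro U hU
    have hintegrable : ∀ v ∈ U, Integrable ((G v).indicator fun _ => (1 : ℝ)) P := fun v hv =>
      (integrable_const 1).indicator (hG v (hU hv))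
    obtain ⟨c, hc⟩ := exists_integral_le (μ := P)
      (f := fun c => ∑ v ∈ U, (G v).indicator (fun _ => (1 : ℝ)) c) (integrable_finsetSum U hintegrable)
    refine ⟨c, ?_⟩
    rw [integral_finsetSum U hintegrable] at hc
    calc p * U.card = ∑ v ∈ U, p := by rw [Finset.sum_const, nsmul_eq_mul, mul_comm]
      _ ≤ ∑ v ∈ U, ∫ c, (G v).indicator (fun _ => (1 : ℝ)) c ∂P := by
          refine Finset.sum_le_sum fun v hv => ?_
          rw [integral_indicator_const _ (hG v (hU hv)), smul_eq_mul, mul_one]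
          exact hPG v (hU hv)
      _ ≤ ∑ v ∈ U, (G v).indicator (fun _ => (1 : ℝ)) c := hc
      _ = _ := by simp [Set.indicator_apply, Finset.sum_boole]
  have greedy : ∀ n : ℕ, ∃ S : Finset Ω, S.card ≤ n ∧
      ((V.filter fun v => ∀ c ∈ S, c ∉ G v).card : ℝ) ≤ (1 - p) ^ n * V.card := by
    intro n
    induction n with
    | zero => exact ⟨∅, by simp⟩
    | succ n ih =>
      obtain ⟨S, hS, hcard⟩ := ih
      set U := V.filter fun v => ∀ c ∈ S, c ∉ G v with hU
      obtain ⟨c, hc⟩ := step U (Finset.filter_subset _ _)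
      refine ⟨insert c S, (Finset.card_insert_le _ _).trans (by omega), ?_⟩
      have h1 : (V.filter fun v => ∀ c' ∈ insert c S, c' ∉ G v) = U.filter fun v => c ∉ G v := by
        ext v
        simp only [hU, Finset.mem_filter, Finset.forall_mem_insert]
        tauto
      have h2 := Finset.card_filter_add_card_filter_not (s := U) (fun v => c ∈ G v)
      rw [h1]
      have h3 : ((U.filter fun v => c ∈ G v).card : ℝ) + (U.filter fun v => c ∉ G v).card
          = U.card := by exact_mod_cast h2
      calc ((U.filter fun v => c ∉ G v).card : ℝ) ≤ (1 - p) * U.card := by linarith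
        _ ≤ (1 - p) * ((1 - p) ^ n * V.card) :=
          mul_le_mul_of_nonneg_left hcard (by linarith)
        _ = _ := by ring
  obtain ⟨S, hS, hcard⟩ := greedy n
  have hne : ∀ v : ι, ∃ c : Ω, v ∈ V → c ∈ G v := by
    intro v
    by_cases hv : v ∈ V
    · have : (G v).Nonempty := by
        by_contra h
        have := hPG v hv
        rw [Set.not_nonempty_iff_eq_empty.1 h, measureReal_empty] at this
        linarith
      exact ⟨this.some, fun _ => this.some_mem⟩
    · obtain ⟨c⟩ := nonempty_of_isProbabilityMeasure P
      exact ⟨c, fun h => absurd h hv⟩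
  -- Each target still missed after `n` greedy choices receives a point of its own.
  choose f hf using hne
  set U := V.filter fun v => ∀ c ∈ S, c ∉ G v with hU
  refine ⟨S ∪ U.image f, ?_, ?_⟩
  · have h1 : (S ∪ U.image f).card ≤ S.card + U.card :=
      (Finset.card_union_le _ _).trans (Nat.add_le_add_left Finset.card_image_le _)
    have h2 : ((S ∪ U.image f).card : ℝ) ≤ S.card + U.card := by exact_mod_cast h1
    have h3 : (S.card : ℝ) ≤ n := by exact_mod_cast hS
    linarith
  · intro v hv
    by_cases h : ∃ c ∈ S, c ∈ G v
    · obtain ⟨c, hc, hcv⟩ := h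
      exact ⟨c, Finset.mem_union_left _ hc, hcv⟩
    · push Not at h
      exact ⟨f v, Finset.mem_union_right _ (Finset.mem_image_of_mem f
        (Finset.mem_filter.2 ⟨hv, h⟩)), hf v hv⟩

end VolumeCovering

/-! ### Volume of the lens cut out by two orthogonal balls. -/

section Lens

open MeasureTheory Metric Module

variable {E : Type*} [NormedAddCommGroup E] [InnerProductSpace ℝ E] [FiniteDimensional ℝ E]
  [MeasurableSpace E] [BorelSpace E] (ν : Measure E) [ν.IsAddHaarMeasure]

theorem one_sub_half_div_pow_ge {n : ℕ} (hn : 1 ≤ n) : (1 / 2 : ℝ) ≤ (1 - 1 / (2 * n)) ^ n := by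
  have hn' : (1 : ℝ) ≤ n := by exact_mod_cast hn
  have h := one_add_mul_le_pow (a := -(1 / (2 * n) : ℝ)) (by
    have : 1 / (2 * n : ℝ) ≤ 1 := by rw [div_le_one (by positivity)]; linarith
    linarith) n
  have h2 : (1 : ℝ) + n * -(1 / (2 * n)) = 1 / 2 := by field_simp; norm_num
  rw [h2] at h
  simpa [sub_eq_add_neg] using h

/-- For a unit vector `x`, the spheres of radius `s` about `x` and `R` about `0` meet in a sphere of
radius `s R` at height `R²` along `x`. Shrinking the transverse radius by `1 - e / 2` frees `3/8 ·
s² e`, and descending by `v ≤ s e / 8` uses at most `s² e / 8` three times (twice from `2 s² v`,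
once from `v²`). The second ball only gains from the descent, because `v ≤ 1 ≤ 2 R²`. -/
theorem lens_inequalities {s R e v W : ℝ} (hs1 : s ≤ 1) (hR2 : 1 / 2 ≤ R ^ 2)
    (h1 : s ^ 2 + R ^ 2 = 1) (he0 : 0 ≤ e) (he1 : e ≤ 1) (hv0 : 0 ≤ v) (hv : v ≤ s * e / 8)
    (hW : W ≤ 1) :
    (s ^ 2 + v) ^ 2 + (s * R * (1 - e / 2)) ^ 2 * W ≤ s ^ 2 ∧
      (R ^ 2 - v) ^ 2 + (s * R * (1 - e / 2)) ^ 2 * W ≤ R ^ 2 := by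
  have haW : (s * R * (1 - e / 2)) ^ 2 * W ≤ (s * R * (1 - e / 2)) ^ 2 :=
    mul_le_of_le_one_right (sq_nonneg _) hW
  have hs2 : 0 ≤ s ^ 2 := sq_nonneg s
  have hse : s * e ≤ e := mul_le_of_le_one_left he0 hs1
  have hee : e * e ≤ e := mul_le_of_le_one_left he0 he1
  have ha2 : (s * R * (1 - e / 2)) ^ 2 ≤ s ^ 2 * R ^ 2 - s ^ 2 * (3 / 8 * e) := by
    have h3 : (s * R * (1 - e / 2)) ^ 2 = s ^ 2 * R ^ 2 - s ^ 2 * (R ^ 2 * (e - e * e / 4)) := by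
      ring
    have h4 : 1 / 2 * (e - e * e / 4) ≤ R ^ 2 * (e - e * e / 4) :=
      mul_le_mul_of_nonneg_right hR2 (by linarith)
    have h5 := mul_le_mul_of_nonneg_left (a := s ^ 2)
      (show 3 / 8 * e ≤ R ^ 2 * (e - e * e / 4) by linarith) hs2
    linarith
  have hve : v ≤ e / 8 := by linarith
  constructor
  · have h5 : s ^ 2 * v ≤ s ^ 2 * (e / 8) := mul_le_mul_of_nonneg_left hve hs2
    have h6 : v ^ 2 ≤ s ^ 2 * (e / 8) := by
      calc v ^ 2 ≤ (s * e / 8) ^ 2 := pow_le_pow_left₀ hv0 hv 2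
        _ = s ^ 2 * (e * e / 64) := by ring
        _ ≤ s ^ 2 * (e / 8) := mul_le_mul_of_nonneg_left (by linarith) hs2
    have h7 : s ^ 2 * s ^ 2 + s ^ 2 * R ^ 2 = s ^ 2 := by rw [← mul_add, h1, mul_one]
    have h8 : (s ^ 2 + v) ^ 2 = s ^ 2 * s ^ 2 + 2 * (s ^ 2 * v) + v ^ 2 := by ring
    linarith
  · have h4 : v * v ≤ 2 * R ^ 2 * v := mul_le_mul_of_nonneg_right (by linarith) hv0
    have h7 : s ^ 2 * R ^ 2 + R ^ 2 * R ^ 2 = R ^ 2 := by rw [← add_mul, h1, one_mul]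
    have h8 : (R ^ 2 - v) ^ 2 = R ^ 2 * R ^ 2 - 2 * R ^ 2 * v + v * v := by ring
    have h9 := mul_nonneg hs2 he0
    linarith

/-- The lens of two orthogonally intersecting balls contains an ellipsoid of comparable volume. -/
theorem volume_lens_ge_of_le (hd : 1 ≤ finrank ℝ E) {x : E} (hx : ‖x‖ = 1) {s R : ℝ}
    (hs : 0 < s) (hsR : s ≤ R) (h1 : s ^ 2 + R ^ 2 = 1) :
    (s * R) ^ finrank ℝ E / (32 * finrank ℝ E) * ν.real (ball 0 1) ≤
      ν.real (closedBall x s ∩ closedBall 0 R) := by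
  set n := finrank ℝ E with hn
  have hn1 : (1 : ℝ) ≤ n := by exact_mod_cast hd
  have hR : 0 < R := hs.trans_le hsR
  have hR2 : 1 / 2 ≤ R ^ 2 := by nlinarith
  have hs1 : s ≤ 1 := by nlinarith
  have hR1 : R ≤ 1 := by nlinarith
  set e : ℝ := 1 / n with he
  have he0 : 0 < e := by positivity
  have he1 : e ≤ 1 := by rw [he, div_le_one (by positivity)]; exact hn1
  set a : ℝ := s * R * (1 - e / 2) with ha
  set h : ℝ := s * e / 16 with hh
  have ha0 : 0 < a := by
    have : 0 < 1 - e / 2 := by linarith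
    positivity
  have hh0 : 0 < h := by positivity
  -- `T` scales by `h` along `x` and by `a` orthogonally to it, which gives an ellipsoid that is
  -- flat in the direction `x`.
  set T : E →ₗ[ℝ] E := a • LinearMap.transvection (innerₛₗ ℝ x) ((h / a - 1) • x) with hT
  have hTdet : LinearMap.det T = a ^ n * (h / a) := by
    rw [hT, LinearMap.det_smul, LinearMap.transvection.det]
    simp [hx, hn]
  have hTz : ∀ z, T z = a • z + ((h - a) * inner ℝ x z) • x := by
    intro z
    rw [hT, LinearMap.smul_apply, LinearMap.transvection.apply, smul_add, smul_smul, smul_smul]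
    congr 2
    simp only [innerₛₗ_apply_apply]
    field_simp
  have hsub : (fun z => (R ^ 2 - h) • x + T z) '' ball 0 1 ⊆ closedBall x s ∩ closedBall 0 R := by
    rintro _ ⟨z, hz, rfl⟩
    rw [mem_ball, dist_zero_right] at hz
    set u : ℝ := inner ℝ x z with hu
    have hux : inner ℝ z x = u := real_inner_comm _ _
    have hxx : inner ℝ x x = (1 : ℝ) := by rw [real_inner_self_eq_norm_sq, hx]; norm_num
    have huz : u ^ 2 ≤ ‖z‖ ^ 2 := by
      have := abs_real_inner_le_norm x z
      rw [hx, one_mul] at this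
      rw [← sq_abs]
      exact pow_le_pow_left₀ (abs_nonneg _) this 2
    have hz2 : ‖z‖ ^ 2 ≤ 1 := by nlinarith [norm_nonneg z]
    set W := ‖z‖ ^ 2 - u ^ 2 with hW
    have hW0 : 0 ≤ W := by linarith
    have hW1 : W ≤ 1 := by nlinarith [sq_nonneg u]
    have hu1 : |u| ≤ 1 := abs_le_one_iff_mul_self_le_one.2 (by nlinarith)
    -- The ellipsoid is centred at height `R² - h`, so all its points lie at heights `R² - v` with
    -- `0 ≤ v ≤ 2 h`.
    set v := h * (1 - u) with hv
    have hv0 : 0 ≤ v := mul_nonneg hh0.le (by linarith [(abs_le.1 hu1).2])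
    have hv1 : v ≤ 2 * h := by nlinarith [(abs_le.1 hu1).1]
    set y := (R ^ 2 - h) • x + T z with hy
    have hy1 : y = (R ^ 2 - h + (h - a) * u) • x + a • z := by
      rw [hy, hTz, add_smul]; abel
    have hyn : ‖y‖ ^ 2 = (R ^ 2 - v) ^ 2 + a ^ 2 * W := by
      rw [← real_inner_self_eq_norm_sq, hy1]
      simp only [inner_add_left, inner_add_right, real_inner_smul_left, real_inner_smul_right,
        hxx, hux, real_inner_self_eq_norm_sq z, ← hu]
      rw [hv, hW]; ring
    have hxy : inner ℝ y x = R ^ 2 - v := by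
      rw [hy1]
      simp only [inner_add_left, real_inner_smul_left, hxx, hux]
      rw [hv]; ring
    have hyx : ‖y - x‖ ^ 2 = (s ^ 2 + v) ^ 2 + a ^ 2 * W := by
      rw [norm_sub_sq_real, hyn, hxy, hx]
      have : s ^ 2 = 1 - R ^ 2 := by linarith
      rw [this]; ring
    have hv2 : v ≤ s * e / 8 := by rw [hh] at hv1; linarith
    obtain ⟨hA, hB⟩ := lens_inequalities hs1 hR2 h1 he0.le he1 hv0 hv2 hW1
    constructor
    · rw [mem_closedBall, dist_eq_norm]
      refine abs_le_of_sq_le_sq' ?_ hs.le |>.2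
      rwa [hyx]
    · rw [mem_closedBall, dist_zero_right]
      refine abs_le_of_sq_le_sq' ?_ hR.le |>.2
      rwa [hyn]
  have hvol : ν.real ((fun z => (R ^ 2 - h) • x + T z) '' ball 0 1) =
      a ^ n * (h / a) * ν.real (ball 0 1) := by
    have : (fun z => (R ^ 2 - h) • x + T z) '' ball 0 1 =
        (fun y => (R ^ 2 - h) • x + y) '' (T '' ball 0 1) := by rw [Set.image_image]
    rw [this, measureReal_def, Set.image_add_left, measure_preimage_add,
      Measure.addHaar_image_linearMap, ENNReal.toReal_mul,
      ENNReal.toReal_ofReal (abs_nonneg _), hTdet, abs_of_nonneg (by positivity), measureReal_def]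
  have hle := measureReal_mono (μ := ν) hsub
    ((measure_mono Set.inter_subset_left).trans_lt measure_closedBall_lt_top).ne
  rw [hvol] at hle
  refine le_trans (mul_le_mul_of_nonneg_right ?_ measureReal_nonneg) hle
  have h8 : a ^ n * (h / a) = (s * R) ^ n * (1 - e / 2) ^ n * (h / a) := by rw [ha, mul_pow]
  have h9 : (1 / 2 : ℝ) ≤ (1 - e / 2) ^ n := by
    have := one_sub_half_div_pow_ge hd
    rwa [show (1 : ℝ) / (2 * n) = e / 2 by rw [he]; field_simp] at this
  have h10 : e / 16 ≤ h / a := by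
    rw [le_div_iff₀ ha0, hh]
    have : a ≤ s := by
      rw [ha, mul_assoc]
      exact mul_le_of_le_one_right hs.le (by nlinarith)
    nlinarith
  rw [h8]
  calc (s * R) ^ n / (32 * n) = (s * R) ^ n * (1 / 2) * (e / 16) := by rw [he]; field_simp; norm_num
    _ ≤ _ := by gcongr

/-- The reflection `y ↦ x - y` exchanges the roles of the two balls, which removes the assumption `s
≤ R`. -/
theorem volume_lens_ge (hd : 1 ≤ finrank ℝ E) {x : E} (hx : ‖x‖ = 1) {s R : ℝ}
    (hs : 0 < s) (hR : 0 < R) (h1 : s ^ 2 + R ^ 2 = 1) :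
    (s * R) ^ finrank ℝ E / (32 * finrank ℝ E) * ν.real (ball 0 1) ≤
      ν.real (closedBall x s ∩ closedBall 0 R) := by
  rcases le_total s R with h | h
  · exact volume_lens_ge_of_le ν hd hx hs h h1
  · have h2 := volume_lens_ge_of_le ν hd hx hR h (by linarith)
    have h3 : closedBall x R ∩ closedBall 0 s =
        (fun y => x - y) ⁻¹' (closedBall x s ∩ closedBall 0 R) := by
      ext y
      simp only [Set.mem_inter_iff, mem_closedBall, dist_eq_norm, Set.mem_preimage, sub_zero]
      rw [sub_sub_cancel_left, norm_neg, ← norm_neg (y - x), neg_sub, and_comm]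
    rw [h3, measureReal_def ν (_ ⁻¹' _), (ν.measurePreserving_sub_left x).measure_preimage
      (measurableSet_closedBall.inter measurableSet_closedBall).nullMeasurableSet, ← measureReal_def] at h2
    rwa [mul_comm s R]

end Lens

/-! ### Covering a ball with accuracy proportional to the norm. -/

section BallCovering

open MeasureTheory Metric Module
open scoped Pointwise

theorem one_third_le_div_succ_pow {n : ℕ} (hn : 1 ≤ n) : (1 / 3 : ℝ) ≤ (n / (n + 1)) ^ n := by
  have hn' : (1 : ℝ) ≤ n := by exact_mod_cast hn
  have h1 : ((n + 1) / n : ℝ) ^ n ≤ 3 := by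
    have h2 : ((n + 1) / n : ℝ) ≤ Real.exp (1 / n) := by
      have := Real.add_one_le_exp (1 / n : ℝ)
      rwa [show (1 / n + 1 : ℝ) = (n + 1) / n by field_simp; ring] at this
    calc ((n + 1) / n : ℝ) ^ n ≤ Real.exp (1 / n) ^ n := by gcongr
      _ = Real.exp 1 := by rw [← Real.exp_nat_mul]; congr 1; field_simp
      _ ≤ 3 := by linarith [Real.exp_one_lt_d9]
  have h3 : (n / (n + 1) : ℝ) ^ n = (((n + 1) / n : ℝ) ^ n)⁻¹ := by rw [← inv_pow, inv_div]
  rw [h3, one_div]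
  exact inv_anti₀ (by positivity) h1

variable {E : Type*} [NormedAddCommGroup E] [InnerProductSpace ℝ E] [FiniteDimensional ℝ E]

/-- The proportion of centres in a concentric ball that serve a given point of the annulus. -/
theorem volume_ball_inter_ge [MeasurableSpace E] [BorelSpace E] (ν : Measure E)
    [ν.IsAddHaarMeasure] (hd : 1 ≤ finrank ℝ E) {s R : ℝ} (hs : 0 < s) (hR : 0 < R)
    (h1 : s ^ 2 + R ^ 2 = 1) {v : E} (hv : (finrank ℝ E : ℝ) / (finrank ℝ E + 1) ≤ ‖v‖)
    (hv1 : ‖v‖ ≤ 1) :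
    s ^ finrank ℝ E / (96 * finrank ℝ E) * ν.real (closedBall 0 R) ≤
      ν.real (closedBall 0 R ∩ closedBall v (s * ‖v‖)) := by
  set n := finrank ℝ E with hn
  have hn1 : (1 : ℝ) ≤ n := by exact_mod_cast hd
  have hv0 : 0 < ‖v‖ := lt_of_lt_of_le (by positivity) hv
  have hx : ‖(‖v‖⁻¹ • v)‖ = 1 := by
    rw [norm_smul, norm_inv, norm_norm, inv_mul_cancel₀ hv0.ne']
  have hlens := volume_lens_ge ν hd hx hs hR h1
  have hsub : ‖v‖ • (closedBall (‖v‖⁻¹ • v) s ∩ closedBall 0 R) ⊆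
      closedBall 0 R ∩ closedBall v (s * ‖v‖) := by
    rintro _ ⟨y, ⟨hy1, hy2⟩, rfl⟩
    rw [mem_closedBall, dist_eq_norm] at hy1
    rw [mem_closedBall, dist_zero_right] at hy2
    constructor
    · change ‖v‖ • y ∈ _
      rw [mem_closedBall, dist_zero_right, norm_smul, norm_norm]
      nlinarith [norm_nonneg y]
    · change ‖v‖ • y ∈ _
      rw [mem_closedBall, dist_eq_norm]
      have : ‖v‖ • y - v = ‖v‖ • (y - ‖v‖⁻¹ • v) := by
        rw [smul_sub, smul_smul, mul_inv_cancel₀ hv0.ne', one_smul]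
      rw [this, norm_smul, norm_norm, mul_comm]
      exact mul_le_mul_of_nonneg_right hy1 hv0.le
  have hle := measureReal_mono (μ := ν) hsub
    ((measure_mono Set.inter_subset_left).trans_lt measure_closedBall_lt_top).ne
  rw [measureReal_def ν (_ • _), Measure.addHaar_smul, ENNReal.toReal_mul,
    ENNReal.toReal_ofReal (abs_nonneg _), abs_of_nonneg (by positivity), ← measureReal_def] at hle
  refine le_trans ?_ hle
  rw [measureReal_def ν (closedBall _ _), Measure.addHaar_closedBall ν _ hR.le,
    ENNReal.toReal_mul, ENNReal.toReal_ofReal (by positivity), ← measureReal_def, ← hn]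
  -- The annulus is thin enough that rescaling the lens from norm `1` to `‖v‖` loses only a factor
  -- `3`.
  have h3 : (1 / 3 : ℝ) ≤ ‖v‖ ^ n :=
    (one_third_le_div_succ_pow hd).trans (pow_le_pow_left₀ (by positivity) hv n)
  calc s ^ n / (96 * n) * (R ^ n * ν.real (ball 0 1))
      = 1 / 3 * ((s * R) ^ n / (32 * n) * ν.real (ball 0 1)) := by
        rw [mul_pow]; field_simp; ring
    _ ≤ ‖v‖ ^ n * ν.real (closedBall (‖v‖⁻¹ • v) s ∩ closedBall 0 R) := by gcongr

/-- A thin annulus is covered, with radii proportional to the norm, by boundedly many balls up to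
a polynomial factor in the dimension. -/
theorem exists_annulus_cover (hd : 1 ≤ finrank ℝ E) {s : ℝ} (hs : 0 < s) (hs1 : s < 1) :
    ∃ S : Finset E, (S.card : ℝ) ≤ 3800 * (finrank ℝ E : ℝ) ^ 3 / s ^ finrank ℝ E ∧
      ∀ x : E, (finrank ℝ E : ℝ) / (finrank ℝ E + 1) ≤ ‖x‖ → ‖x‖ ≤ 1 →
        ∃ c ∈ S, ‖x - c‖ ≤ s * ‖x‖ := by
  borelize E
  let ν : Measure E := Measure.addHaar
  set n := finrank ℝ E with hn
  have hn1 : (1 : ℝ) ≤ n := by exact_mod_cast hd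
  set e : ℝ := 1 / (2 * n) with he
  have he0 : 0 < e := by positivity
  have he1 : e ≤ 1 / 2 := by
    rw [he]; exact one_div_le_one_div_of_le (by norm_num) (by linarith)
  -- The factor `1 - 1 / (2n)` at most halves `sⁿ`, and leaves room `s e ‖x‖ ≥ s e / 2 = 2 δ` to
  -- pass from net points to all points of the annulus.
  set s' := s * (1 - e) with hs'
  have hs'0 : 0 < s' := mul_pos hs (by linarith)
  have hs's : s' ≤ s := mul_le_of_le_one_right hs.le (by linarith)
  have hs'1 : s' < 1 := by linarith
  set R := √(1 - s' ^ 2) with hR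
  have hR2 : 0 < 1 - s' ^ 2 := by nlinarith
  have hR0 : 0 < R := Real.sqrt_pos.2 hR2
  have hsR : s' ^ 2 + R ^ 2 = 1 := by rw [hR, Real.sq_sqrt hR2.le]; ring
  set δ := s * e / 4 with hδ
  have hδ0 : 0 < δ := by positivity
  obtain ⟨V, hV1, hV2, hV3⟩ := exists_finset_net_closedBall (E := E) (a := 1) (r := δ)
    zero_le_one hδ0 (K := {x | (n : ℝ) / (n + 1) ≤ ‖x‖ ∧ ‖x‖ ≤ 1}) (by
      intro x hx; rw [mem_closedBall, dist_zero_right]; exact hx.2)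
  have hΩ : 0 < ν.real (closedBall (0 : E) R) :=
    ENNReal.toReal_pos (measure_closedBall_pos ν 0 hR0).ne' measure_closedBall_lt_top.ne
  have hΩ0 : ν (closedBall (0 : E) R) ≠ 0 := (measure_closedBall_pos ν 0 hR0).ne'
  let P : Measure E := ProbabilityTheory.cond ν (closedBall 0 R)
  have : IsProbabilityMeasure P :=
    ProbabilityTheory.cond_isProbabilityMeasure_of_finite hΩ0 measure_closedBall_lt_top.ne
  set p : ℝ := s ^ n / (192 * n) with hp
  have hsn : s ^ n ≤ 1 := pow_le_one₀ hs.le hs1.le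
  have hp0 : 0 < p := by positivity
  have hp1 : p ≤ 1 := by
    rw [hp, div_le_one (by positivity)]; linarith
  have hs'n : s ^ n / 2 ≤ s' ^ n := by
    rw [hs', mul_pow]
    have := one_sub_half_div_pow_ge hd
    rw [← he] at this
    have h2 : 0 < s ^ n := by positivity
    nlinarith
  -- The net has at most `((s + 16 n) / s)ⁿ ≤ exp (17 n²) / sⁿ` points, so after `N` choices at most
  -- `1 / sⁿ` of them are unserved.
  set N : ℕ := ⌈17 * (n : ℝ) ^ 2 / p⌉₊ with hN
  obtain ⟨S, hS1, hS2⟩ := exists_finset_hitting P V (fun v => closedBall v (s' * ‖v‖))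
    (fun _ _ => measurableSet_closedBall) hp0 hp1 (by
      intro v hv
      have hv' := hV1 hv
      have h3 := volume_ball_inter_ge ν hd hs'0 hR0 hsR hv'.1 hv'.2
      rw [measureReal_def, ProbabilityTheory.cond_apply measurableSet_closedBall,
        ENNReal.toReal_mul, ENNReal.toReal_inv, ← measureReal_def, ← measureReal_def,
        inv_mul_eq_div, le_div_iff₀ hΩ]
      refine le_trans (mul_le_mul_of_nonneg_right ?_ hΩ.le) h3
      rw [hp, ← hn]
      calc s ^ n / (192 * n) = (s ^ n / 2) / (96 * n) := by field_simp; norm_num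
        _ ≤ s' ^ n / (96 * n) := by gcongr) N
  refine ⟨S, ?_, ?_⟩
  · have hN1 : (N : ℝ) ≤ 17 * (n : ℝ) ^ 2 / p + 1 := (Nat.ceil_lt_add_one (by positivity)).le
    have hN2 : 17 * (n : ℝ) ^ 2 ≤ N * p := (div_le_iff₀ hp0).1 (Nat.le_ceil _)
    have h4 : (1 - p) ^ N ≤ Real.exp (-(17 * (n : ℝ) ^ 2)) := by
      calc (1 - p) ^ N ≤ Real.exp (-p) ^ N :=
            pow_le_pow_left₀ (by linarith) (Real.one_sub_le_exp_neg p) N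
        _ = Real.exp (-(N * p)) := by rw [← Real.exp_nat_mul]; congr 1; ring
        _ ≤ _ := Real.exp_le_exp.2 (by linarith)
    have h5 : (V.card : ℝ) ≤ Real.exp (17 * (n : ℝ) ^ 2) / s ^ n := by
      refine hV3.trans ?_
      have h6 : 1 + 2 * 1 / δ ≤ Real.exp (17 * n) / s := by
        have h7 : 1 + 2 * 1 / δ = (s + 16 * n) / s := by
          rw [hδ, he]; field_simp; ring
        rw [h7]
        gcongr
        linarith [Real.add_one_le_exp (17 * (n : ℝ))]
      calc (1 + 2 * 1 / δ) ^ n ≤ (Real.exp (17 * n) / s) ^ n := by gcongr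
        _ = _ := by rw [div_pow, ← Real.exp_nat_mul]; congr 2; ring
    have h6 : (1 - p) ^ N * V.card ≤ 1 / s ^ n := by
      calc (1 - p) ^ N * V.card
          ≤ Real.exp (-(17 * (n : ℝ) ^ 2)) * (Real.exp (17 * (n : ℝ) ^ 2) / s ^ n) := by gcongr
        _ = 1 / s ^ n := by rw [← mul_div_assoc, ← Real.exp_add]; simp
    have h7 : 17 * (n : ℝ) ^ 2 / p = 3264 * ((n : ℝ) ^ 3 / s ^ n) := by
      rw [hp]; field_simp; norm_num
    have h8 : 1 ≤ 1 / s ^ n := by rw [le_div_iff₀ (by positivity)]; linarith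
    have h9 : 1 / s ^ n ≤ (n : ℝ) ^ 3 / s ^ n := by
      gcongr; exact one_le_pow₀ hn1
    have h10 : 0 ≤ (n : ℝ) ^ 3 / s ^ n := by positivity
    rw [mul_div_assoc 3800]
    linarith
  · intro x hx1 hx2
    obtain ⟨v, hv, hxv⟩ := hV2 x ⟨hx1, hx2⟩
    obtain ⟨c, hc, hcv⟩ := hS2 v hv
    refine ⟨c, hc, ?_⟩
    rw [mem_closedBall, dist_comm, dist_eq_norm] at hcv
    rw [dist_eq_norm] at hxv
    have h1 : ‖x - c‖ ≤ δ + s' * ‖v‖ := by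
      calc ‖x - c‖ = ‖(x - v) + (v - c)‖ := by congr 1; abel
        _ ≤ _ := (norm_add_le _ _).trans (add_le_add hxv hcv)
    have h2 : ‖v‖ ≤ ‖x‖ + δ := by
      have := norm_sub_norm_le v x
      rw [norm_sub_rev] at this
      linarith
    have h3 : (1 / 2 : ℝ) ≤ ‖x‖ := by
      refine le_trans ?_ hx1
      rw [div_le_div_iff₀ (by norm_num) (by positivity)]; linarith
    have h4 : s' * ‖v‖ ≤ s' * ‖x‖ + δ := by nlinarith
    have h5 : s' * ‖x‖ = s * ‖x‖ - s * e * ‖x‖ := by rw [hs']; ring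
    have h6 : s * e * (1 / 2) ≤ s * e * ‖x‖ := by gcongr
    rw [hδ] at h1 h4
    linarith

/-- The unit ball is covered by balls whose squared radius at `x` is `s² (‖x‖² + τ²)`, with at most
`s⁻ⁿ` centres up to a factor polynomial in `n` and `τ⁻¹`. -/
theorem exists_unitBall_cover (hd : 1 ≤ finrank ℝ E) {s τ : ℝ} (hs : 0 < s) (hs1 : s < 1)
    (hτ : 0 < τ) (hτ1 : τ ≤ 1) :
    ∃ S : Finset E, (S.card : ℝ) ≤ 59049 * (finrank ℝ E : ℝ) ^ 4 / τ / s ^ finrank ℝ E ∧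
      ∀ x : E, ‖x‖ ≤ 1 → ∃ c ∈ S, ‖x - c‖ ^ 2 ≤ s ^ 2 * (‖x‖ ^ 2 + τ ^ 2) := by
  classical
  set n := finrank ℝ E with hn
  have hn1 : (1 : ℝ) ≤ n := by exact_mod_cast hd
  have hsn : s ^ n ≤ 1 := pow_le_one₀ hs.le hs1.le
  have hsn0 : 0 < s ^ n := by positivity
  obtain ⟨S₀, h01, h02⟩ : ∃ S : Finset E, (S.card : ℝ) ≤ 1 / s ^ n ∧
      ∀ x : E, ‖x‖ ≤ τ / 8 → ∃ c ∈ S, ‖x - c‖ ≤ s * τ := by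
    -- In the core the allowed error is `s τ`. For `s ≥ 1/8` the origin alone suffices; otherwise
    -- the volumetric count is `((s + 1/4) / s)ⁿ ≤ s⁻ⁿ`.
    rcases le_total (1 / 8) s with h | h
    · refine ⟨{0}, ?_, fun x hx => ⟨0, Finset.mem_singleton_self _, ?_⟩⟩
      · rw [Finset.card_singleton, Nat.cast_one, le_div_iff₀ hsn0]; linarith
      · rw [sub_zero]; nlinarith
    · obtain ⟨S, -, h2, h3⟩ := exists_finset_net_closedBall (E := E) (a := τ / 8) (r := s * τ)
        (by positivity) (by positivity) subset_rfl
      refine ⟨S, h3.trans ?_, fun x hx => ?_⟩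
      · have h4 : 1 + 2 * (τ / 8) / (s * τ) ≤ 1 / s := by
          have : 1 + 2 * (τ / 8) / (s * τ) = (s + 1 / 4) / s := by field_simp; ring
          rw [this]
          gcongr
          linarith
        rw [← one_div_pow]
        gcongr
      · obtain ⟨y, hy, hxy⟩ := h2 x (by rwa [mem_closedBall, dist_zero_right])
        exact ⟨y, hy, by rwa [← dist_eq_norm]⟩
  obtain ⟨S₁, h11, h12⟩ := exists_annulus_cover (E := E) hd hs hs1
  -- Outer radii `(i + 1) / M` in arithmetic progression: a point with `‖x‖ ≥ τ / 8` has `i ≥ n`, so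
  -- `i / (i + 1) ≥ n / (n + 1)` and rescaling puts it in the thin annulus. The index `i = M` occurs
  -- when `‖x‖ = 1`.
  set M : ℕ := ⌈8 * n / τ⌉₊ with hM
  have hnτ : 1 ≤ n / τ := by rw [le_div_iff₀ hτ]; linarith
  have hM1 : 8 * n / τ ≤ M := Nat.le_ceil _
  have hM2 : (M : ℝ) ≤ 8 * n / τ + 1 := (Nat.ceil_lt_add_one (by positivity)).le
  have hM0 : (0 : ℝ) < M := lt_of_lt_of_le (by positivity) hM1
  refine ⟨S₀ ∪ (Finset.range (M + 1)).biUnion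
    fun i => S₁.image fun c => ((i + 1 : ℝ) / M) • c, ?_, ?_⟩
  · have h1 : (S₀ ∪ (Finset.range (M + 1)).biUnion
        fun i => S₁.image fun c => ((i + 1 : ℝ) / M) • c).card ≤ S₀.card + (M + 1) * S₁.card := by
      refine (Finset.card_union_le _ _).trans (Nat.add_le_add_left ?_ _)
      refine (Finset.card_biUnion_le_card_mul _ _ S₁.card fun i _ => Finset.card_image_le).trans ?_
      rw [Finset.card_range]
    have h2 : ((S₀ ∪ (Finset.range (M + 1)).biUnion
        fun i => S₁.image fun c => ((i + 1 : ℝ) / M) • c).card : ℝ) ≤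
        S₀.card + (M + 1) * S₁.card := by exact_mod_cast h1
    refine h2.trans ?_
    have h3 : (M + 1 : ℝ) ≤ 10 * (n / τ) := by
      rw [mul_div_assoc] at hM2; linarith
    have h4 : (M + 1 : ℝ) * S₁.card ≤ 10 * (n / τ) * (3800 * (n : ℝ) ^ 3 / s ^ n) := by gcongr
    have h5 : 10 * (n / τ) * (3800 * (n : ℝ) ^ 3 / s ^ n) = 38000 * ((n : ℝ) ^ 4 / τ / s ^ n) := by
      field_simp; ring
    have h6 : 1 / s ^ n ≤ (n : ℝ) ^ 4 / τ / s ^ n := by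
      gcongr
      rw [le_div_iff₀ hτ]
      nlinarith [one_le_pow₀ hn1 (n := 4)]
    have h7 : 59049 * (n : ℝ) ^ 4 / τ / s ^ n = 59049 * ((n : ℝ) ^ 4 / τ / s ^ n) := by ring
    rw [h7]
    linarith [show 0 < 1 / s ^ n by positivity]
  · intro x hx
    rcases le_total ‖x‖ (τ / 8) with h | h
    · obtain ⟨c, hc, hxc⟩ := h02 x h
      refine ⟨c, Finset.mem_union_left _ hc, ?_⟩
      calc ‖x - c‖ ^ 2 ≤ (s * τ) ^ 2 := by gcongr
        _ ≤ _ := by rw [mul_pow]; gcongr; nlinarith [sq_nonneg ‖x‖]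
    · set i := ⌊‖x‖ * M⌋₊ with hi
      have hi1 : (i : ℝ) ≤ ‖x‖ * M := Nat.floor_le (by positivity)
      have hi2 : ‖x‖ * M < i + 1 := Nat.lt_floor_add_one _
      have hi3 : i ≤ M := Nat.floor_le_of_le (by nlinarith)
      have hin : n ≤ i := by
        refine Nat.le_floor ?_
        calc (n : ℝ) = τ / 8 * (8 * n / τ) := by field_simp
          _ ≤ ‖x‖ * M := by gcongr
      have hin' : (n : ℝ) ≤ i := by exact_mod_cast hin
      set t : ℝ := (i + 1) / M with ht
      have ht0 : 0 < t := by positivity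
      have hnx : ‖t⁻¹ • x‖ = ‖x‖ * M / (i + 1) := by
        rw [norm_smul, norm_inv, Real.norm_of_nonneg ht0.le, ht, inv_div]; ring
      obtain ⟨c, hc, hxc⟩ := h12 (t⁻¹ • x) (by
        rw [hnx, div_le_div_iff₀ (by positivity) (by positivity)]
        nlinarith) (by
        rw [hnx, div_le_one (by positivity)]; exact hi2.le)
      refine ⟨t • c, Finset.mem_union_right _ (Finset.mem_biUnion.2 ⟨i, Finset.mem_range.2 (by omega),
        Finset.mem_image_of_mem _ hc⟩), ?_⟩
      have h1 : x - t • c = t • (t⁻¹ • x - c) := by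
        rw [smul_sub, smul_smul, mul_inv_cancel₀ ht0.ne', one_smul]
      have h2 : ‖x - t • c‖ ≤ s * ‖x‖ := by
        rw [h1, norm_smul, Real.norm_of_nonneg ht0.le]
        calc t * ‖t⁻¹ • x - c‖ ≤ t * (s * ‖t⁻¹ • x‖) := by gcongr
          _ = s * ‖x‖ := by
            rw [norm_smul, norm_inv, Real.norm_of_nonneg ht0.le]; field_simp
      calc ‖x - t • c‖ ^ 2 ≤ (s * ‖x‖) ^ 2 := by gcongr
        _ ≤ _ := by rw [mul_pow]; gcongr; nlinarith [sq_nonneg τ]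

end BallCovering

/-! ### Finite-dimensional ellipsoids: volume, nets and dyadic shells. -/

section FiniteEllipsoid

open MeasureTheory Metric Module

variable {ι : Type*} [Fintype ι] [DecidableEq ι]

/-- Division of the `i`-th coordinate by `m i`. -/
noncomputable def coordDiv (m : ι → ℝ) : EuclideanSpace ℝ ι →ₗ[ℝ] EuclideanSpace ℝ ι :=
  Matrix.toLpLin 2 2 (Matrix.diagonal fun i => (m i)⁻¹)

theorem coordDiv_apply (m : ι → ℝ) (y : EuclideanSpace ℝ ι) (i : ι) :
    coordDiv m y i = y i / m i := by
  simp [coordDiv, Matrix.mulVec_diagonal, div_eq_inv_mul]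

theorem norm_coordDiv_sq (m : ι → ℝ) (y : EuclideanSpace ℝ ι) :
    ‖coordDiv m y‖ ^ 2 = ∑ i, (y i / m i) ^ 2 := by
  rw [EuclideanSpace.real_norm_sq_eq]
  simp only [coordDiv_apply]

theorem det_coordDiv (m : ι → ℝ) : LinearMap.det (coordDiv m) = ∏ i, (m i)⁻¹ := by
  rw [coordDiv, Matrix.toLpLin_eq_toLin, LinearMap.det_toLin, Matrix.det_diagonal]

theorem norm_coordDiv_le {m : ι → ℝ} {ε : ℝ} (hε : 0 < ε) (hm : ∀ i, ε ≤ m i)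
    (y : EuclideanSpace ℝ ι) : ‖coordDiv m y‖ ≤ ‖y‖ / ε := by
  refine abs_le_of_sq_le_sq' ?_ (by positivity) |>.2
  rw [norm_coordDiv_sq, div_pow, EuclideanSpace.real_norm_sq_eq, Finset.sum_div]
  refine Finset.sum_le_sum fun i _ => ?_
  rw [div_pow]
  have := hm i
  gcongr

theorem volume_real_ellipsoid {m : ι → ℝ} (hm : ∀ i, 0 < m i) {t : ℝ} (ht : 0 ≤ t) :
    volume.real {y : EuclideanSpace ℝ ι | ‖coordDiv m y‖ ≤ t} =
      t ^ Fintype.card ι * (∏ i, m i) * volume.real (ball (0 : EuclideanSpace ℝ ι) 1) := by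
  have h1 : {y : EuclideanSpace ℝ ι | ‖coordDiv m y‖ ≤ t} = coordDiv m ⁻¹' closedBall 0 t := by
    ext y; simp
  have hprod : 0 < ∏ i, m i := Finset.prod_pos fun i _ => hm i
  have hdet : LinearMap.det (coordDiv m) = (∏ i, m i)⁻¹ := by
    rw [det_coordDiv, Finset.prod_inv_distrib]
  rw [h1, measureReal_def, Measure.addHaar_preimage_linearMap _ (by rw [hdet]; positivity), hdet,
    inv_inv, abs_of_pos hprod, Measure.addHaar_closedBall _ _ ht, finrank_euclideanSpace,
    ENNReal.toReal_mul, ENNReal.toReal_mul, ENNReal.toReal_ofReal hprod.le,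
    ENNReal.toReal_ofReal (by positivity), ← measureReal_def]
  ring

theorem volume_ellipsoid_ne_top {m : ι → ℝ} (hm : ∀ i, 0 < m i) {t : ℝ} :
    volume {y : EuclideanSpace ℝ ι | ‖coordDiv m y‖ ≤ t} ≠ ∞ := by
  have h1 : {y : EuclideanSpace ℝ ι | ‖coordDiv m y‖ ≤ t} = coordDiv m ⁻¹' closedBall 0 t := by
    ext y; simp
  have hdet : LinearMap.det (coordDiv m) ≠ 0 := by
    rw [det_coordDiv]
    exact Finset.prod_ne_zero_iff.2 fun i _ => inv_ne_zero (hm i).ne'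
  rw [h1, Measure.addHaar_preimage_linearMap _ hdet]
  exact ENNReal.mul_ne_top ENNReal.ofReal_ne_top measure_closedBall_lt_top.ne

/-- Volume lower bound for the number of balls covering an ellipsoid. -/
theorem prod_semiAxes_le_card_mul_pow {m : ι → ℝ} (hm : ∀ i, 0 < m i) {ρ : ℝ} (hρ : 0 ≤ ρ)
    (S : Finset (EuclideanSpace ℝ ι))
    (hS : ∀ y : EuclideanSpace ℝ ι, ‖coordDiv m y‖ ≤ 1 → ∃ c ∈ S, dist y c ≤ ρ) :
    ∏ i, m i ≤ S.card * ρ ^ Fintype.card ι := by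
  have hv : 0 < volume.real (ball (0 : EuclideanSpace ℝ ι) 1) :=
    ENNReal.toReal_pos (measure_ball_pos _ 0 one_pos).ne' measure_ball_lt_top.ne
  have hsub : {y : EuclideanSpace ℝ ι | ‖coordDiv m y‖ ≤ 1} ⊆ ⋃ c ∈ S, closedBall c ρ := by
    intro y hy
    obtain ⟨c, hc, h⟩ := hS y hy
    exact Set.mem_biUnion hc h
  have hle : volume.real {y : EuclideanSpace ℝ ι | ‖coordDiv m y‖ ≤ 1} ≤
      ∑ c ∈ S, volume.real (closedBall c ρ) := by
    refine (measureReal_mono hsub ?_).trans (measureReal_biUnion_finset_le _ _)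
    exact (measure_biUnion_lt_top S.finite_toSet fun _ _ => measure_closedBall_lt_top).ne
  rw [volume_real_ellipsoid hm zero_le_one, one_pow, one_mul] at hle
  have hball : ∀ c : EuclideanSpace ℝ ι, volume.real (closedBall c ρ) =
      ρ ^ Fintype.card ι * volume.real (ball (0 : EuclideanSpace ℝ ι) 1) := by
    intro c
    rw [measureReal_def, Measure.addHaar_closedBall _ _ hρ, finrank_euclideanSpace,
      ENNReal.toReal_mul, ENNReal.toReal_ofReal (by positivity), ← measureReal_def]
  rw [Finset.sum_congr rfl fun c _ => hball c, Finset.sum_const, nsmul_eq_mul, ← mul_assoc] at hle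
  exact le_of_mul_le_mul_right hle hv

/-- Because every semi-axis is at least `ε`, a ball of radius `ε / 4` lies in a quarter of the
ellipsoid. Balls of that radius about `ε / 2`-separated points thus stay in the `5/4`-dilate, and
the volume ratio produces `5 = (5/4) / (1/4)`. -/
theorem exists_ellipsoid_net {m : ι → ℝ} {ε : ℝ} (hε : 0 < ε) (hm : ∀ i, ε ≤ m i) :
    ∃ S : Finset (EuclideanSpace ℝ ι),
      (S.card : ℝ) * ε ^ Fintype.card ι ≤ 5 ^ Fintype.card ι * ∏ i, m i ∧
      ∀ y : EuclideanSpace ℝ ι, ‖coordDiv m y‖ ≤ 1 → ∃ c ∈ S, ‖y - c‖ ≤ ε / 2 := by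
  have hm0 : ∀ i, 0 < m i := fun i => hε.trans_le (hm i)
  obtain ⟨S, -, h2, h3⟩ := exists_finset_net_of_volume (volume : Measure (EuclideanSpace ℝ ι))
    (K := {y | ‖coordDiv m y‖ ≤ 1}) (K' := {y | ‖coordDiv m y‖ ≤ 5 / 4}) (r := ε / 2)
    (by positivity) (volume_ellipsoid_ne_top hm0) (by
      intro x hx y hy
      rw [mem_ball, dist_eq_norm] at hy
      have h4 : ‖coordDiv m (y - x)‖ ≤ 1 / 4 := by
        refine (norm_coordDiv_le hε hm _).trans ?_
        rw [div_le_iff₀ hε]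
        linarith
      change ‖coordDiv m y‖ ≤ 5 / 4
      change ‖coordDiv m x‖ ≤ 1 at hx
      calc ‖coordDiv m y‖ = ‖coordDiv m x + coordDiv m (y - x)‖ := by
            rw [← map_add]; congr 2; abel
        _ ≤ 1 + 1 / 4 := (norm_add_le _ _).trans (add_le_add hx h4)
        _ = 5 / 4 := by norm_num)
  have hv : 0 < volume.real (ball (0 : EuclideanSpace ℝ ι) 1) :=
    ENNReal.toReal_pos (measure_ball_pos _ 0 one_pos).ne' measure_ball_lt_top.ne
  refine ⟨S, ?_, fun y hy => ?_⟩
  · rw [volume_real_ellipsoid hm0 (by norm_num), finrank_euclideanSpace, ← mul_assoc] at h3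
    have h4 := le_of_mul_le_mul_right h3 hv
    have h5 : ε / 2 / 2 = ε * (1 / 4) := by ring
    rw [h5, mul_pow, show (5 / 4 : ℝ) = 5 * (1 / 4) by norm_num, mul_pow] at h4
    have h6 : (0 : ℝ) < (1 / 4) ^ Fintype.card ι := by positivity
    refine le_of_mul_le_mul_right ?_ h6
    calc _ = _ := by ring
      _ ≤ _ := h4
      _ = _ := by ring
  · obtain ⟨c, hc, h⟩ := h2 y hy
    exact ⟨c, hc, by rwa [← dist_eq_norm]⟩

/-- Dyadic shells: a covering of an ellipsoid whose accuracy improves towards the centre. -/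
theorem exists_ellipsoid_shell_cover {m : ι → ℝ} {ε : ℝ} (hε : 0 < ε) (hm : ∀ i, ε ≤ m i)
    (n : ℕ) :
    ∃ S : Finset (EuclideanSpace ℝ ι),
      (S.card : ℝ) * ε ^ Fintype.card ι ≤ (n + 1) * (5 ^ Fintype.card ι * ∏ i, m i) ∧
      ∀ y : EuclideanSpace ℝ ι, ‖coordDiv m y‖ ≤ 1 →
        ∃ c ∈ S, ‖y - c‖ ^ 2 ≤ ε ^ 2 * (‖coordDiv m y‖ ^ 2 + (1 / 4) ^ n) := by
  classical
  obtain ⟨S, h1, h2⟩ := exists_ellipsoid_net hε hm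
  -- One net serves every shell: scaled by `2⁻ⁱ`, its error `ε 2⁻ⁱ⁻¹` is at most `ε ‖coordDiv m y‖`
  -- on the `i`-th shell.
  have hscale : ∀ (i : ℕ) (y : EuclideanSpace ℝ ι), ‖coordDiv m y‖ ≤ (1 / 2) ^ i →
      ∃ c ∈ S, ‖y - (1 / 2 : ℝ) ^ i • c‖ ≤ ε * (1 / 2) ^ (i + 1) := by
    intro i y hy
    have h2i : (0 : ℝ) < (1 / 2) ^ i := by positivity
    obtain ⟨c, hc, hyc⟩ := h2 (((1 / 2 : ℝ) ^ i)⁻¹ • y) (by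
      rw [map_smul, norm_smul, norm_inv, Real.norm_of_nonneg h2i.le, inv_mul_le_iff₀ h2i, mul_one]
      exact hy)
    refine ⟨c, hc, ?_⟩
    have h3 : y - (1 / 2 : ℝ) ^ i • c = (1 / 2 : ℝ) ^ i • (((1 / 2 : ℝ) ^ i)⁻¹ • y - c) := by
      rw [smul_sub, smul_smul, mul_inv_cancel₀ h2i.ne', one_smul]
    rw [h3, norm_smul, Real.norm_of_nonneg h2i.le, pow_succ]
    nlinarith
  have hshell : ∀ (n : ℕ) (y : EuclideanSpace ℝ ι), ‖coordDiv m y‖ ≤ 1 →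
      (∃ i < n, (1 / 2) ^ (i + 1) ≤ ‖coordDiv m y‖ ∧ ‖coordDiv m y‖ ≤ (1 / 2) ^ i) ∨
        ‖coordDiv m y‖ ≤ (1 / 2) ^ n := by
    intro n y hy
    induction n with
    | zero => right; simpa using hy
    | succ n ih =>
      rcases ih with ⟨i, hi, h⟩ | h
      · exact Or.inl ⟨i, by omega, h⟩
      · rcases le_total ‖coordDiv m y‖ ((1 / 2) ^ (n + 1)) with h' | h'
        · exact Or.inr h'
        · exact Or.inl ⟨n, by omega, h', h⟩
  refine ⟨(Finset.range (n + 1)).biUnion fun i => S.image fun c => (1 / 2 : ℝ) ^ i • c, ?_, ?_⟩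
  · have h3 : ((Finset.range (n + 1)).biUnion
        fun i => S.image fun c => (1 / 2 : ℝ) ^ i • c).card ≤ (n + 1) * S.card := by
      refine (Finset.card_biUnion_le_card_mul _ _ S.card fun i _ => Finset.card_image_le).trans ?_
      rw [Finset.card_range]
    have h4 : (((Finset.range (n + 1)).biUnion
        fun i => S.image fun c => (1 / 2 : ℝ) ^ i • c).card : ℝ) ≤ (n + 1) * S.card := by
      exact_mod_cast h3
    calc _ ≤ ((n + 1) * S.card : ℝ) * ε ^ Fintype.card ι := by gcongr
      _ = (n + 1) * (S.card * ε ^ Fintype.card ι) := by ring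
      _ ≤ _ := by gcongr
  · intro y hy
    have hmem : ∀ i ≤ n, ∀ c ∈ S, (1 / 2 : ℝ) ^ i • c ∈
        (Finset.range (n + 1)).biUnion fun i => S.image fun c => (1 / 2 : ℝ) ^ i • c :=
      fun i hi c hc => Finset.mem_biUnion.2
        ⟨i, Finset.mem_range.2 (by omega), Finset.mem_image_of_mem _ hc⟩
    rcases hshell n y hy with ⟨i, hi, h3, h4⟩ | h
    · obtain ⟨c, hc, h5⟩ := hscale i y h4
      refine ⟨_, hmem i hi.le c hc, ?_⟩
      calc _ ≤ (ε * (1 / 2) ^ (i + 1)) ^ 2 := by gcongr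
        _ ≤ (ε * ‖coordDiv m y‖) ^ 2 := by gcongr
        _ ≤ _ := by
          rw [mul_pow]; gcongr
          exact le_add_of_nonneg_right (by positivity)
    · obtain ⟨c, hc, h5⟩ := hscale n y h
      refine ⟨_, hmem n le_rfl c hc, ?_⟩
      calc _ ≤ (ε * (1 / 2) ^ (n + 1)) ^ 2 := by gcongr
        _ ≤ (ε * (1 / 2) ^ n) ^ 2 := by
          gcongr ?_ ^ 2
          refine mul_le_mul_of_nonneg_left ?_ hε.le
          exact pow_le_pow_of_le_one (by norm_num) (by norm_num) (by omega)
        _ = ε ^ 2 * (1 / 4) ^ n := by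
          rw [mul_pow, ← pow_mul, mul_comm n 2, pow_mul]; norm_num
        _ ≤ _ := by
          gcongr
          exact le_add_of_nonneg_left (by positivity)

end FiniteEllipsoid

/-! ### Passage between block sequences and their first `k` blocks. -/

section BlockSpace

open Metric Module

variable {d : ℕ → ℕ}

theorem hasSum_norm_sq_blockSpace (x : BlockSpace d) :
    HasSum (fun j => ‖x j‖ ^ 2) (‖x‖ ^ 2) := by
  have := lp.hasSum_norm (p := 2) (by norm_num) x
  simpa using this

/-- The coordinates of the first `k` blocks. -/
noncomputable def headProj (k : ℕ) (x : BlockSpace d) :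
    EuclideanSpace ℝ (Σ j : Fin k, Fin (d j)) :=
  WithLp.toLp 2 fun i => x i.1 i.2

/-- Extension by zero from the first `k` blocks. -/
noncomputable def headEmb (k : ℕ) (y : EuclideanSpace ℝ (Σ j : Fin k, Fin (d j))) :
    BlockSpace d :=
  ⟨fun j => if h : j < k then WithLp.toLp 2 fun i => y ⟨⟨j, h⟩, i⟩ else 0,
    (memℓp_zero ((Set.finite_lt_nat k).subset fun j hj => by
      by_contra h
      exact hj (dif_neg h))).of_exponent_ge bot_le⟩

theorem headEmb_apply_of_lt {k : ℕ} (y : EuclideanSpace ℝ (Σ j : Fin k, Fin (d j))) {j : ℕ}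
    (h : j < k) : headEmb k y j = WithLp.toLp 2 fun i => y ⟨⟨j, h⟩, i⟩ :=
  dif_pos h

theorem headEmb_apply_of_le {k : ℕ} (y : EuclideanSpace ℝ (Σ j : Fin k, Fin (d j))) {j : ℕ}
    (h : k ≤ j) : headEmb k y j = 0 :=
  dif_neg (by omega)

theorem headProj_sub (k : ℕ) (x y : BlockSpace d) :
    headProj k (x - y) = headProj k x - headProj k y := by
  ext i
  simp [headProj]

theorem headProj_headEmb (k : ℕ) (y : EuclideanSpace ℝ (Σ j : Fin k, Fin (d j))) :
    headProj k (headEmb k y) = y := by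
  ext ⟨j, i⟩
  simp [headProj, headEmb_apply_of_lt y j.2]

theorem norm_headProj_sq (k : ℕ) (x : BlockSpace d) :
    ‖headProj k x‖ ^ 2 = ∑ j ∈ Finset.range k, ‖x j‖ ^ 2 := by
  rw [EuclideanSpace.real_norm_sq_eq, Fintype.sum_sigma, Finset.sum_range]
  refine Finset.sum_congr rfl fun j _ => ?_
  rw [EuclideanSpace.real_norm_sq_eq]
  rfl

theorem norm_coordDiv_headProj_sq (μ : ℕ → ℝ) (k : ℕ) (x : BlockSpace d) :
    ‖coordDiv (fun i : (Σ j : Fin k, Fin (d j)) => μ i.1) (headProj k x)‖ ^ 2 =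
      ∑ j ∈ Finset.range k, (‖x j‖ / μ j) ^ 2 := by
  rw [norm_coordDiv_sq, Fintype.sum_sigma, Finset.sum_range]
  refine Finset.sum_congr rfl fun j _ => ?_
  rw [div_pow, EuclideanSpace.real_norm_sq_eq, Finset.sum_div]
  refine Finset.sum_congr rfl fun i _ => ?_
  rw [div_pow]
  rfl

theorem norm_headProj_le (k : ℕ) (x : BlockSpace d) : ‖headProj k x‖ ≤ ‖x‖ := by
  refine abs_le_of_sq_le_sq' ?_ (norm_nonneg x) |>.2
  rw [norm_headProj_sq]
  exact sum_le_hasSum _ (fun _ _ => by positivity) (hasSum_norm_sq_blockSpace x)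

/-- A real `tsum` is `0` on divergent series, so summability, implicit in the extended norm, has to
be recorded separately. -/
theorem mem_mixedEllipsoid_iff {μ : ℕ → ℝ} {x : BlockSpace d} :
    x ∈ mixedEllipsoid d μ ↔
      Summable (fun j => (‖x j‖ / μ j) ^ 2) ∧ ∑' j, (‖x j‖ / μ j) ^ 2 ≤ 1 := by
  have hnn : ∀ j, 0 ≤ (‖x j‖ / μ j) ^ 2 := fun j => sq_nonneg _
  have h1 : x ∈ mixedEllipsoid d μ ↔ ∑' j, ENNReal.ofReal ((‖x j‖ / μ j) ^ 2) ≤ 1 := by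
    change (∑' j, ENNReal.ofReal ((‖x j‖ / μ j) ^ 2)) ^ (1 / 2 : ℝ) ≤ 1 ↔ _
    conv_lhs => rw [← ENNReal.one_rpow (1 / 2 : ℝ)]
    exact ENNReal.rpow_le_rpow_iff (by norm_num)
  rw [h1]
  constructor
  · intro h
    have hs : Summable (fun j => (‖x j‖ / μ j) ^ 2) := by
      have := ENNReal.summable_toReal (ne_top_of_le_ne_top ENNReal.one_ne_top h)
      simpa only [ENNReal.toReal_ofReal (hnn _)] using this
    refine ⟨hs, ?_⟩
    rw [← ENNReal.ofReal_tsum_of_nonneg hnn hs] at h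
    exact ENNReal.ofReal_le_one.1 h
  · rintro ⟨hs, h⟩
    rw [← ENNReal.ofReal_tsum_of_nonneg hnn hs]
    exact ENNReal.ofReal_le_one.2 h

/-- Beyond the `k`-th block the ellipsoid is contained in a ball of radius `ε`. -/
theorem norm_sub_headEmb_sq_le {μ : ℕ → ℝ} (hμ : ∀ n, 0 < μ n) {k : ℕ} {ε : ℝ}
    (hε : ∀ j, k ≤ j → μ j ≤ ε) {x : BlockSpace d} (hx : x ∈ mixedEllipsoid d μ)
    (c : EuclideanSpace ℝ (Σ j : Fin k, Fin (d j))) :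
    ‖x - headEmb k c‖ ^ 2 ≤ ‖headProj k x - c‖ ^ 2 + ε ^ 2 *
      (1 - ‖coordDiv (fun i : (Σ j : Fin k, Fin (d j)) => μ i.1) (headProj k x)‖ ^ 2) := by
  obtain ⟨hs, hle⟩ := mem_mixedEllipsoid_iff.1 hx
  have h1 := hasSum_norm_sq_blockSpace (x - headEmb k c)
  have h2 := h1.summable.sum_add_tsum_nat_add k
  have h3 := hs.sum_add_tsum_nat_add k
  rw [h1.tsum_eq, ← norm_headProj_sq, headProj_sub, headProj_headEmb] at h2
  rw [← norm_coordDiv_headProj_sq] at h3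
  have h4 : ∑' j, ‖(x - headEmb k c) (j + k)‖ ^ 2 ≤
      ∑' j, ε ^ 2 * (‖x (j + k)‖ / μ (j + k)) ^ 2 := by
    refine Summable.tsum_le_tsum (fun j => ?_) ((summable_nat_add_iff k).2 h1.summable)
      (((summable_nat_add_iff k).2 hs).mul_left _)
    have h5 : (x - headEmb k c) (j + k) = x (j + k) := by
      rw [lp.coeFn_sub, Pi.sub_apply, headEmb_apply_of_le c (by omega), sub_zero]
    rw [h5, ← mul_pow]
    refine pow_le_pow_left₀ (norm_nonneg _) ?_ 2
    rw [← mul_div_assoc, le_div_iff₀ (hμ _), mul_comm]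
    exact mul_le_mul_of_nonneg_right (hε _ (by omega)) (norm_nonneg _)
  rw [tsum_mul_left] at h4
  have h6 := mul_le_mul_of_nonneg_left (a := ε ^ 2) (show
    ∑' j, (‖x (j + k)‖ / μ (j + k)) ^ 2 ≤ 1 - ‖coordDiv (fun i : (Σ j : Fin k, Fin (d j)) => μ i.1)
      (headProj k x)‖ ^ 2 by linarith) (sq_nonneg ε)
  linarith

/-- Finite-dimensional coverings that are fine near the centre yield coverings of the mixed
ellipsoid. -/
theorem mixedCoveringNumber_le_card {μ : ℕ → ℝ} (hμ : ∀ n, 0 < μ n) {k : ℕ} {ε ρ : ℝ}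
    (hρ : 0 ≤ ρ) (hε : ∀ j, k ≤ j → μ j ≤ ε)
    (S : Finset (EuclideanSpace ℝ (Σ j : Fin k, Fin (d j))))
    (hS : ∀ y, ‖coordDiv (fun i : (Σ j : Fin k, Fin (d j)) => μ i.1) y‖ ≤ 1 →
      ∃ c ∈ S, ‖y - c‖ ^ 2 + ε ^ 2 *
        (1 - ‖coordDiv (fun i : (Σ j : Fin k, Fin (d j)) => μ i.1) y‖ ^ 2) ≤ ρ ^ 2) :
    mixedCoveringNumber d μ ρ ≤ S.card := by
  classical
  have hcover : IsCover ρ.toNNReal (mixedEllipsoid d μ) (S.image (headEmb k) : Finset _) := by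
    rw [isCover_iff_subset_iUnion_closedBall]
    intro x hx
    obtain ⟨hs, hle⟩ := mem_mixedEllipsoid_iff.1 hx
    obtain ⟨c, hc, h⟩ := hS (headProj k x) (by
      refine abs_le_of_sq_le_sq' ?_ zero_le_one |>.2
      rw [norm_coordDiv_headProj_sq, one_pow]
      exact (hs.sum_le_tsum _ fun _ _ => sq_nonneg _).trans hle)
    refine Set.mem_biUnion (Finset.mem_coe.2 (Finset.mem_image_of_mem _ hc)) ?_
    rw [mem_closedBall, dist_eq_norm, Real.coe_toNNReal _ hρ]
    exact (abs_le_of_sq_le_sq' ((norm_sub_headEmb_sq_le hμ hε hx c).trans h) hρ).2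
  refine hcover.externalCoveringNumber_le_encard.trans ?_
  rw [Set.encard_coe_eq_coe_finsetCard]
  exact_mod_cast Finset.card_image_le

/-- The volume lower bound for the covering number of the mixed ellipsoid. -/
theorem prod_semiAxes_le_coveringNumber {μ : ℕ → ℝ} (hμ : ∀ n, 0 < μ n) (k : ℕ) {ρ : ℝ}
    (hρ : 0 ≤ ρ) (hN : mixedCoveringNumber d μ ρ ≠ ⊤) :
    ∏ i : (Σ j : Fin k, Fin (d j)), μ i.1 ≤ (mixedCoveringNumber d μ ρ).toNat *
      ρ ^ Fintype.card (Σ j : Fin k, Fin (d j)) := by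
  classical
  have : Nonempty {C : Set (BlockSpace d) // IsCover ρ.toNNReal (mixedEllipsoid d μ) C} :=
    ⟨_, IsCover.rfl⟩
  -- An infimum in `ℕ∞` over a nonempty family is attained, so an optimal cover exists.
  obtain ⟨⟨C, hC⟩, hCe⟩ := ENat.exists_eq_iInf
    (fun C : {C : Set (BlockSpace d) // IsCover ρ.toNNReal (mixedEllipsoid d μ) C} =>
      (C : Set (BlockSpace d)).encard)
  have hCN : C.encard = mixedCoveringNumber d μ ρ := by
    rw [hCe, iInf_subtype]; rfl
  have hfin : C.Finite := Set.encard_ne_top_iff.1 (hCN ▸ hN)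
  have hcard : hfin.toFinset.card = (mixedCoveringNumber d μ ρ).toNat := by
    rw [← hCN, hfin.encard_eq_coe_toFinset_card, ENat.toNat_natCast]
  rw [isCover_iff_subset_iUnion_closedBall] at hC
  have h := prod_semiAxes_le_card_mul_pow
    (m := fun i : (Σ j : Fin k, Fin (d j)) => μ i.1) (fun i => hμ _) hρ
    (hfin.toFinset.image (headProj k)) (by
      intro y hy
      have hmem : headEmb k y ∈ mixedEllipsoid d μ := by
        have hz : ∀ j ∉ Finset.range k, (‖headEmb k y j‖ / μ j) ^ 2 = 0 := by
          intro j hj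
          rw [headEmb_apply_of_le y (by simpa using hj)]
          simp
        rw [mem_mixedEllipsoid_iff]
        refine ⟨summable_of_ne_finset_zero hz, ?_⟩
        rw [tsum_eq_sum hz, ← norm_coordDiv_headProj_sq, headProj_headEmb]
        exact pow_le_one₀ (norm_nonneg _) hy
      obtain ⟨c, hc, hyc⟩ := Set.mem_iUnion₂.1 (hC hmem)
      rw [mem_closedBall, dist_eq_norm, Real.coe_toNNReal _ hρ] at hyc
      refine ⟨headProj k c, Finset.mem_image_of_mem _ (hfin.mem_toFinset.2 hc), ?_⟩
      rw [dist_eq_norm, ← headProj_headEmb k y, ← headProj_sub]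
      exact (norm_headProj_le k _).trans hyc)
  refine h.trans (mul_le_mul_of_nonneg_right ?_ (by positivity))
  rw [← hcard]
  exact_mod_cast Finset.card_image_le

/-- The product of the coverings of the individual blocks. -/
theorem exists_block_cover {k : ℕ} {μ : ℕ → ℝ} {ε τ : ℝ} (hε : 0 < ε)
    (hμ : ∀ j < k, ε < μ j) (hd : ∀ j < k, 1 ≤ d j) (hτ : 0 < τ) (hτ1 : τ ≤ 1) :
    ∃ S : Finset (EuclideanSpace ℝ (Σ j : Fin k, Fin (d j))),
      (S.card : ℝ) ≤ ∏ j : Fin k, (59049 * (d j : ℝ) ^ 4 / τ * (μ j / ε) ^ d j) ∧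
      ∀ y, ‖coordDiv (fun i : (Σ j : Fin k, Fin (d j)) => μ i.1) y‖ ≤ 1 →
        ∃ c ∈ S, ‖y - c‖ ^ 2 ≤ ε ^ 2 *
          (‖coordDiv (fun i : (Σ j : Fin k, Fin (d j)) => μ i.1) y‖ ^ 2 + k * τ ^ 2) := by
  classical
  have hblock : ∀ j : Fin k, ∃ S : Finset (EuclideanSpace ℝ (Fin (d j))),
      (S.card : ℝ) ≤ 59049 * (d j : ℝ) ^ 4 / τ * (μ j / ε) ^ d j ∧
      ∀ x, ‖x‖ ≤ μ j → ∃ c ∈ S, ‖x - c‖ ^ 2 ≤ ε ^ 2 * ((‖x‖ / μ j) ^ 2 + τ ^ 2) := by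
    intro j
    have hμj := hμ j j.2
    have hμ0 : 0 < μ j := hε.trans hμj
    obtain ⟨S, h1, h2⟩ := exists_unitBall_cover (E := EuclideanSpace ℝ (Fin (d j)))
      (s := ε / μ j) (by rw [finrank_euclideanSpace_fin]; exact hd j j.2) (by positivity)
      ((div_lt_one hμ0).2 hμj) hτ hτ1
    rw [finrank_euclideanSpace_fin, div_eq_mul_inv _ ((ε / μ j) ^ d j), ← inv_pow, inv_div] at h1
    refine ⟨S.image fun c => μ j • c, le_trans (by exact_mod_cast Finset.card_image_le) h1, ?_⟩
    intro x hx
    have hxn : ‖(μ j)⁻¹ • x‖ = ‖x‖ / μ j := by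
      rw [norm_smul, norm_inv, Real.norm_of_nonneg hμ0.le, inv_mul_eq_div]
    obtain ⟨c, hc, hxc⟩ := h2 ((μ j)⁻¹ • x) (by rw [hxn]; exact (div_le_one hμ0).2 hx)
    refine ⟨μ j • c, Finset.mem_image_of_mem _ hc, ?_⟩
    have h3 : x - μ j • c = μ j • ((μ j)⁻¹ • x - c) := by
      rw [smul_sub, smul_smul, mul_inv_cancel₀ hμ0.ne', one_smul]
    rw [hxn] at hxc
    rw [h3, norm_smul, Real.norm_of_nonneg hμ0.le, mul_pow]
    calc _ ≤ μ j ^ 2 * ((ε / μ j) ^ 2 * ((‖x‖ / μ j) ^ 2 + τ ^ 2)) := by gcongr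
      _ = _ := by field_simp
  choose S hS1 hS2 using hblock
  let glue : (∀ j : Fin k, EuclideanSpace ℝ (Fin (d j))) →
      EuclideanSpace ℝ (Σ j : Fin k, Fin (d j)) := fun c => WithLp.toLp 2 fun i => c i.1 i.2
  refine ⟨(Fintype.piFinset S).image glue, ?_, ?_⟩
  · calc _ ≤ ((Fintype.piFinset S).card : ℝ) := by exact_mod_cast Finset.card_image_le
      _ = ∏ j, ((S j).card : ℝ) := by rw [Fintype.card_piFinset, Nat.cast_prod]
      _ ≤ _ := Finset.prod_le_prod (fun _ _ => by positivity) fun j _ => hS1 j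
  · intro y hy
    let z : ∀ j : Fin k, EuclideanSpace ℝ (Fin (d j)) := fun j => WithLp.toLp 2 fun i => y ⟨j, i⟩
    have hq : ‖coordDiv (fun i : (Σ j : Fin k, Fin (d j)) => μ i.1) y‖ ^ 2 =
        ∑ j, (‖z j‖ / μ j) ^ 2 := by
      rw [norm_coordDiv_sq, Fintype.sum_sigma]
      refine Finset.sum_congr rfl fun j _ => ?_
      rw [div_pow, EuclideanSpace.real_norm_sq_eq, Finset.sum_div]
      refine Finset.sum_congr rfl fun i _ => ?_
      rw [div_pow]
    have hz : ∀ j, ‖z j‖ ≤ μ j := by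
      intro j
      have hμ0 : 0 < μ j := hε.trans (hμ j j.2)
      rw [← div_le_one hμ0]
      refine abs_le_of_sq_le_sq' ?_ zero_le_one |>.2
      calc (‖z j‖ / μ j) ^ 2 ≤ ∑ j, (‖z j‖ / μ j) ^ 2 :=
            Finset.single_le_sum (f := fun j => (‖z j‖ / μ j) ^ 2) (fun _ _ => sq_nonneg _)
              (Finset.mem_univ j)
        _ ≤ 1 ^ 2 := by rw [← hq]; gcongr
    -- Squared errors add over blocks, and each is proportional to that block's share of `‖coordDiv
    -- _ y‖²`; no allocation of `q` among the blocks has to be guessed.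
    choose c hc1 hc2 using fun j => hS2 j (z j) (hz j)
    refine ⟨glue c, Finset.mem_image_of_mem _ (Fintype.mem_piFinset.2 hc1), ?_⟩
    have hn : ‖y - glue c‖ ^ 2 = ∑ j, ‖z j - c j‖ ^ 2 := by
      rw [EuclideanSpace.real_norm_sq_eq, Fintype.sum_sigma]
      refine Finset.sum_congr rfl fun j _ => ?_
      rw [EuclideanSpace.real_norm_sq_eq]
      rfl
    rw [hn, hq]
    calc _ ≤ ∑ j : Fin k, ε ^ 2 * ((‖z j‖ / μ j) ^ 2 + τ ^ 2) :=
          Finset.sum_le_sum fun j _ => hc2 j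
      _ = _ := by
        rw [← Finset.mul_sum, Finset.sum_add_distrib, Finset.sum_const, Finset.card_univ,
          Fintype.card_fin, nsmul_eq_mul]

end BlockSpace

/-! ### Logarithmic bookkeeping and the two upper bounds. -/

section Rates

variable {d : ℕ → ℕ}

theorem card_headIndex (d : ℕ → ℕ) (k : ℕ) :
    Fintype.card (Σ j : Fin k, Fin (d j)) = dimBar d k := by
  rw [Fintype.card_sigma, dimBar, Finset.sum_range]
  simp

theorem prod_headIndex (d : ℕ → ℕ) (μ : ℕ → ℝ) (k : ℕ) :
    ∏ i : (Σ j : Fin k, Fin (d j)), μ i.1 = ∏ j ∈ Finset.range k, μ j ^ d j := by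
  rw [Fintype.prod_sigma, Finset.prod_range]
  simp

theorem semiAxisMean_pow {μ : ℕ → ℝ} (hμ : ∀ n, 0 < μ n) {k : ℕ} (hD : dimBar d k ≠ 0) :
    semiAxisMean d μ k ^ dimBar d k = ∏ j ∈ Finset.range k, μ j ^ d j := by
  rw [semiAxisMean, ← Finset.prod_pow]
  refine Finset.prod_congr rfl fun j _ => ?_
  rw [← Real.rpow_mul_natCast (hμ j).le, div_mul_cancel₀ _ (by exact_mod_cast hD),
    Real.rpow_natCast]

theorem semiAxisMean_nonneg {μ : ℕ → ℝ} (hμ : ∀ n, 0 < μ n) (k : ℕ) :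
    0 ≤ semiAxisMean d μ k :=
  Finset.prod_nonneg fun j _ => Real.rpow_nonneg (hμ j).le _

theorem rpow_one_div_mul_pow {N ρ : ℝ} (hN : 0 ≤ N) {n : ℕ} (hn : n ≠ 0) :
    (N ^ (1 / (n : ℝ)) * ρ) ^ n = N * ρ ^ n := by
  rw [mul_pow, one_div, Real.rpow_inv_natCast_pow hN hn]

/-- The relative error `γ k log₂ D / D`. -/
noncomputable def relError (d : ℕ → ℕ) (k : ℕ) (γ : ℝ) : ℝ :=
  γ * (k : ℝ) * Real.logb 2 (dimBar d k : ℝ) / (dimBar d k : ℝ)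

theorem nine_mul_le_dimBar {k : ℕ} (hd : ∀ j < k, 9 ≤ d j) : 9 * k ≤ dimBar d k := by
  calc 9 * k = ∑ _j ∈ Finset.range k, 9 := by simp [mul_comm]
    _ ≤ _ := Finset.sum_le_sum fun j hj => hd j (Finset.mem_range.1 hj)

theorem two_le_logb_dimBar {k : ℕ} (hk : 1 ≤ k) (hd : ∀ j < k, 9 ≤ d j) :
    2 ≤ Real.logb 2 (dimBar d k : ℝ) := by
  have h9 : (9 : ℝ) * k ≤ dimBar d k := by exact_mod_cast nine_mul_le_dimBar hd
  have hk' : (1 : ℝ) ≤ k := by exact_mod_cast hk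
  rw [Real.le_logb_iff_rpow_le (by norm_num) (by linarith)]
  calc (2 : ℝ) ^ (2 : ℝ) = 4 := by norm_num
    _ ≤ _ := by linarith

theorem relError_nonneg {k : ℕ} (hk : 1 ≤ k) (hd : ∀ j < k, 9 ≤ d j) {γ : ℝ} (hγ : 1 ≤ γ) :
    0 ≤ relError d k γ := by
  have := two_le_logb_dimBar hk hd
  unfold relError
  positivity

theorem radius_excess_le {k : ℕ} (hk : 1 ≤ k) (hd : ∀ j < k, 9 ≤ d j) {γ : ℝ} (hγ : 1 ≤ γ) :
    (dimBar d k : ℝ) ^ (-γ) * √((k : ℝ) + 1) ≤ 2 * k / dimBar d k := by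
  have h9 : (9 : ℝ) * k ≤ dimBar d k := by exact_mod_cast nine_mul_le_dimBar hd
  have hk' : (1 : ℝ) ≤ k := by exact_mod_cast hk
  have h1 : (dimBar d k : ℝ) ^ (-γ) ≤ (dimBar d k : ℝ)⁻¹ := by
    rw [← Real.rpow_neg_one]
    exact Real.rpow_le_rpow_of_exponent_le (by linarith) (by linarith)
  have h2 : √((k : ℝ) + 1) ≤ 2 * k := by
    rw [Real.sqrt_le_left (by linarith)]
    nlinarith
  calc _ ≤ (dimBar d k : ℝ)⁻¹ * (2 * k) := by gcongr
    _ = _ := by rw [inv_mul_eq_div]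

/-- Enlarging `ε` to `ε_γ` thus costs a factor within the permitted relative error; the `2` in `2 k
/ D` is absorbed by `log₂ D ≥ 2`. -/
theorem radius_excess_le_relError {k : ℕ} (hk : 1 ≤ k) (hd : ∀ j < k, 9 ≤ d j) {γ : ℝ}
    (hγ : 1 ≤ γ) : (dimBar d k : ℝ) ^ (-γ) * √((k : ℝ) + 1) ≤ relError d k γ := by
  refine (radius_excess_le hk hd hγ).trans ?_
  have h2 := two_le_logb_dimBar hk hd
  have hk' : (1 : ℝ) ≤ k := by exact_mod_cast hk
  refine div_le_div_of_nonneg_right ?_ (Nat.cast_nonneg _)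
  calc (2 : ℝ) * k = 1 * k * 2 := by ring
    _ ≤ γ * k * Real.logb 2 (dimBar d k) := by gcongr

theorem radius_excess_le_one {k : ℕ} (hk : 1 ≤ k) (hd : ∀ j < k, 9 ≤ d j) {γ : ℝ}
    (hγ : 1 ≤ γ) : (dimBar d k : ℝ) ^ (-γ) * √((k : ℝ) + 1) ≤ 1 := by
  refine (radius_excess_le hk hd hγ).trans ?_
  have h9 : (9 : ℝ) * k ≤ dimBar d k := by exact_mod_cast nine_mul_le_dimBar hd
  have hk' : (1 : ℝ) ≤ k := by exact_mod_cast hk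
  rw [div_le_one (by linarith)]
  linarith

/-- The bound from dyadic shells and volume comparison, effective when the relative error is
large. -/
theorem coveringNumber_le_of_shells {μ : ℕ → ℝ} (hμ : ∀ n, 0 < μ n) {k : ℕ} {ε γ : ℝ}
    (hk : 1 ≤ k) (hε : 0 < ε) (hhead : ∀ j < k, ε < μ j) (htail : ∀ j, k ≤ j → μ j ≤ ε)
    (hd : ∀ j < k, 9 ≤ d j) (hγ : 1 ≤ γ) :
    ∃ N : ℕ, mixedCoveringNumber d μ (epsGamma d k γ ε) ≤ N ∧
      (N : ℝ) * epsGamma d k γ ε ^ dimBar d k ≤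
        (10 * (1 + 2 * relError d k γ)) ^ dimBar d k * ∏ j ∈ Finset.range k, μ j ^ d j := by
  set D := dimBar d k with hDdef
  have h9 : (9 : ℝ) * k ≤ D := by exact_mod_cast nine_mul_le_dimBar hd
  have hk' : (1 : ℝ) ≤ k := by exact_mod_cast hk
  have hD0 : (0 : ℝ) < D := by linarith
  have hlog := two_le_logb_dimBar hk hd
  have hη1 := radius_excess_le_one hk hd hγ
  rw [← hDdef] at hlog hη1
  set τ : ℝ := (D : ℝ) ^ (-γ) with hτ
  have hτ0 : 0 < τ := Real.rpow_pos_of_pos hD0 _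
  set η : ℝ := τ * √((k : ℝ) + 1) with hη
  have hτη : τ ≤ η := le_mul_of_one_le_right hτ0.le (Real.one_le_sqrt.2 (by linarith))
  have hρ : epsGamma d k γ ε = ε * (1 + η) := rfl
  -- With this many shells `4⁻ᵐ ≤ D ^ (-γ) = τ`, so the total squared error is at most `ε² (1 + τ) ≤
  -- ε² (1 + η)²`.
  set m : ℕ := ⌈γ * Real.logb 2 D⌉₊ with hm
  have hγlog : 2 ≤ γ * Real.logb 2 D := by nlinarith
  have hm1 : γ * Real.logb 2 D ≤ m := Nat.le_ceil _
  have hm2 : (m : ℝ) ≤ 2 * (γ * Real.logb 2 D) := by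
    have := (Nat.ceil_lt_add_one (a := γ * Real.logb 2 D) (by linarith)).le
    linarith
  have hmτ : (1 / 4 : ℝ) ^ m ≤ τ := by
    have h1 : (1 / 4 : ℝ) ^ m ≤ (1 / 2 : ℝ) ^ m := by gcongr; norm_num
    refine h1.trans ?_
    have h2 : τ = (2 : ℝ) ^ (-(γ * Real.logb 2 D)) := by
      conv_lhs => rw [hτ, ← Real.rpow_logb (b := 2) (by norm_num) (by norm_num) hD0]
      rw [← Real.rpow_mul (by norm_num)]
      congr 1; ring
    rw [h2, one_div, inv_pow, ← Real.rpow_natCast, ← Real.rpow_neg (by norm_num)]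
    exact Real.rpow_le_rpow_of_exponent_le (by norm_num) (by linarith)
  obtain ⟨S, hS1, hS2⟩ := exists_ellipsoid_shell_cover
    (m := fun i : (Σ j : Fin k, Fin (d j)) => μ i.1) hε (fun i => (hhead _ i.1.2).le) m
  rw [card_headIndex, prod_headIndex, ← hDdef] at hS1
  refine ⟨S.card, mixedCoveringNumber_le_card hμ (by rw [hρ]; positivity) htail S ?_, ?_⟩
  · intro y hy
    obtain ⟨c, hc, h⟩ := hS2 y hy
    refine ⟨c, hc, (add_le_add_left h _).trans ?_⟩
    rw [hρ, ← mul_add, mul_pow]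
    refine mul_le_mul_of_nonneg_left ?_ (sq_nonneg ε)
    nlinarith
  · have hP : 0 ≤ ∏ j ∈ Finset.range k, μ j ^ d j :=
      Finset.prod_nonneg fun j _ => pow_nonneg (hμ j).le _
    have hmD : (m : ℝ) / D ≤ 2 * relError d k γ := by
      rw [relError, ← hDdef, ← mul_div_assoc]
      gcongr
      refine hm2.trans ?_
      have : γ * Real.logb 2 D * 1 ≤ γ * Real.logb 2 D * k := by gcongr
      nlinarith
    -- Bernoulli's inequality turns the number of shells into a `D`-th power, ready for the root.
    have hbern : (m : ℝ) + 1 ≤ (1 + m / D) ^ D := by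
      have h := one_add_mul_le_pow (a := (m / D : ℝ)) (by
        have : (0 : ℝ) ≤ m / D := by positivity
        linarith) D
      rwa [mul_div_cancel₀ _ hD0.ne', add_comm] at h
    rw [hρ]
    calc (S.card : ℝ) * (ε * (1 + η)) ^ D ≤ S.card * (ε * 2) ^ D := by
          gcongr; linarith
      _ = S.card * ε ^ D * 2 ^ D := by rw [mul_pow]; ring
      _ ≤ (m + 1) * (5 ^ D * ∏ j ∈ Finset.range k, μ j ^ d j) * 2 ^ D := by gcongr
      _ = 10 ^ D * (m + 1) * ∏ j ∈ Finset.range k, μ j ^ d j := by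
          rw [show (10 : ℝ) = 5 * 2 by norm_num, mul_pow]; ring
      _ ≤ 10 ^ D * (1 + m / D) ^ D * ∏ j ∈ Finset.range k, μ j ^ d j := by gcongr
      _ ≤ 10 ^ D * (1 + 2 * relError d k γ) ^ D * ∏ j ∈ Finset.range k, μ j ^ d j := by gcongr
      _ = _ := by rw [mul_pow]

/-- The bound from products of block coverings, effective when the relative error is small. -/
theorem coveringNumber_le_of_blocks {μ : ℕ → ℝ} (hμ : ∀ n, 0 < μ n) {k : ℕ} {ε γ : ℝ}
    (hk : 1 ≤ k) (hε : 0 < ε) (hhead : ∀ j < k, ε < μ j) (htail : ∀ j, k ≤ j → μ j ≤ ε)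
    (hd : ∀ j < k, 9 ≤ d j) (hγ : 1 ≤ γ) :
    ∃ N : ℕ, mixedCoveringNumber d μ (epsGamma d k γ ε) ≤ N ∧
      (N : ℝ) * epsGamma d k γ ε ^ dimBar d k ≤
        ((1024 : ℝ) ^ relError d k γ * (1 + relError d k γ)) ^ dimBar d k *
          ∏ j ∈ Finset.range k, μ j ^ d j := by
  set D := dimBar d k with hDdef
  have h9 : (9 : ℝ) * k ≤ D := by exact_mod_cast nine_mul_le_dimBar hd
  have hk' : (1 : ℝ) ≤ k := by exact_mod_cast hk
  have hD9 : (9 : ℝ) ≤ D := by linarith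
  have hD0 : (0 : ℝ) < D := by linarith
  have hηL := radius_excess_le_relError hk hd hγ
  rw [← hDdef] at hηL
  set τ : ℝ := (D : ℝ) ^ (-γ) with hτ
  have hτ0 : 0 < τ := Real.rpow_pos_of_pos hD0 _
  have hτ1 : τ ≤ 1 := Real.rpow_le_one_of_one_le_of_nonpos (by linarith) (by linarith)
  set η : ℝ := τ * √((k : ℝ) + 1) with hη
  have hη0 : 0 ≤ η := by positivity
  have hηsq : η ^ 2 = (k + 1) * τ ^ 2 := by
    rw [hη, mul_pow, Real.sq_sqrt (by positivity)]; ring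
  have hρ : epsGamma d k γ ε = ε * (1 + η) := rfl
  obtain ⟨S, hS1, hS2⟩ := exists_block_cover hε hhead
    (fun j hj => (by norm_num : 1 ≤ 9).trans (hd j hj)) hτ0 hτ1
  refine ⟨S.card, mixedCoveringNumber_le_card hμ (by rw [hρ]; positivity) htail S ?_, ?_⟩
  · intro y hy
    obtain ⟨c, hc, h⟩ := hS2 y hy
    refine ⟨c, hc, (add_le_add_left h _).trans ?_⟩
    rw [hρ, ← mul_add, mul_pow]
    refine mul_le_mul_of_nonneg_left ?_ (sq_nonneg ε)
    -- The total error over `ε²` is `1 + k τ²`, below `(1 + η)²` because `η² = (k + 1) τ²`; this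
    -- explains the factor `√(k + 1)` in the radius.
    nlinarith [sq_nonneg τ]
  · have hP : 0 ≤ ∏ j ∈ Finset.range k, μ j ^ d j :=
      Finset.prod_nonneg fun j _ => pow_nonneg (hμ j).le _
    -- As `59049 = 9⁵ ≤ D⁵`, the constant and `d_j⁴` fit into `D⁹ ≤ D ^ (9 γ)`, and `1 / τ` supplies
    -- the last `D ^ γ`.
    have hfac : ∀ j : Fin k, 59049 * (d j : ℝ) ^ 4 / τ ≤ (D : ℝ) ^ (10 * γ) := by
      intro j
      have hdj : (d j : ℝ) ≤ D := by
        exact_mod_cast Finset.single_le_sum (f := d) (fun _ _ => Nat.zero_le _)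
          (Finset.mem_range.2 j.2)
      have h1 : 59049 * (d j : ℝ) ^ 4 ≤ (D : ℝ) ^ (9 * γ) := by
        calc 59049 * (d j : ℝ) ^ 4 ≤ (D : ℝ) ^ 5 * (D : ℝ) ^ 4 := by
              gcongr
              calc (59049 : ℝ) = 9 ^ 5 := by norm_num
                _ ≤ _ := by gcongr
          _ = (D : ℝ) ^ (9 : ℝ) := by rw [← pow_add]; norm_cast
          _ ≤ _ := Real.rpow_le_rpow_of_exponent_le (by linarith) (by linarith)
      rw [div_le_iff₀ hτ0, hτ, ← Real.rpow_add hD0]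
      rwa [show 10 * γ + -γ = 9 * γ by ring]
    have hcard : (S.card : ℝ) * ε ^ D ≤
        ((1024 : ℝ) ^ relError d k γ) ^ D * ∏ j ∈ Finset.range k, μ j ^ d j := by
      have h2 : ((D : ℝ) ^ (10 * γ)) ^ k = ((1024 : ℝ) ^ relError d k γ) ^ D := by
        rw [← Real.rpow_mul_natCast hD0.le, ← Real.rpow_mul_natCast (by norm_num), relError,
          ← hDdef, div_mul_cancel₀ _ hD0.ne', show (1024 : ℝ) = 2 ^ (10 : ℝ) by norm_num,
          ← Real.rpow_mul (by norm_num)]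
        conv_lhs => rw [← Real.rpow_logb (b := 2) (by norm_num) (by norm_num) hD0]
        rw [← Real.rpow_mul (by norm_num)]
        congr 1; ring
      have h3 : ∏ j : Fin k, (59049 * (d j : ℝ) ^ 4 / τ * (μ j / ε) ^ d j) ≤
          ∏ j : Fin k, ((D : ℝ) ^ (10 * γ) * (μ j / ε) ^ d j) := by
        refine Finset.prod_le_prod (fun j _ => ?_) fun j _ => ?_
        · have := hμ j; positivity
        · have := hμ j
          exact mul_le_mul_of_nonneg_right (hfac j) (by positivity)
      have h4 : ∏ j : Fin k, ((D : ℝ) ^ (10 * γ) * (μ j / ε) ^ d j) =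
          ((D : ℝ) ^ (10 * γ)) ^ k * ((∏ j ∈ Finset.range k, μ j ^ d j) / ε ^ D) := by
        rw [Finset.prod_mul_distrib, Finset.prod_const, Finset.card_univ, Fintype.card_fin]
        simp only [div_pow]
        rw [Finset.prod_div_distrib, Finset.prod_pow_eq_pow_sum, Finset.prod_range, hDdef, dimBar,
          Finset.sum_range]
      calc (S.card : ℝ) * ε ^ D
          ≤ ((D : ℝ) ^ (10 * γ)) ^ k * ((∏ j ∈ Finset.range k, μ j ^ d j) / ε ^ D) * ε ^ D := by
            rw [← h4]
            exact mul_le_mul_of_nonneg_right (hS1.trans h3) (by positivity)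
        _ = _ := by rw [h2]; field_simp
    rw [hρ]
    calc (S.card : ℝ) * (ε * (1 + η)) ^ D = S.card * ε ^ D * (1 + η) ^ D := by
          rw [mul_pow]; ring
      _ ≤ ((1024 : ℝ) ^ relError d k γ) ^ D * (∏ j ∈ Finset.range k, μ j ^ d j) *
          (1 + relError d k γ) ^ D := by gcongr
      _ = _ := by rw [mul_pow]; ring

/-- The two covers are exchanged at `L = 1`. Above it, `10 (1 + 2 L) ≤ 30 L`; below it, concavity of
`t ↦ t ^ L` gives `1024 ^ L ≤ 1 + 1023 L`, and `(1 + 1023 L) (1 + L) ≤ 1 + 2047 L`. -/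
theorem coveringNumber_upper_bound {μ : ℕ → ℝ} (hμ : ∀ n, 0 < μ n) {k : ℕ} {ε γ : ℝ}
    (hk : 1 ≤ k) (hε : 0 < ε) (hhead : ∀ j < k, ε < μ j) (htail : ∀ j, k ≤ j → μ j ≤ ε)
    (hd : ∀ j < k, 9 ≤ d j) (hγ : 1 ≤ γ) :
    ∃ N : ℕ, mixedCoveringNumber d μ (epsGamma d k γ ε) ≤ N ∧
      (N : ℝ) * epsGamma d k γ ε ^ dimBar d k ≤
        (1 + 2048 * relError d k γ) ^ dimBar d k * ∏ j ∈ Finset.range k, μ j ^ d j := by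
  have hL0 := relError_nonneg hk hd hγ
  have hP : 0 ≤ ∏ j ∈ Finset.range k, μ j ^ d j :=
    Finset.prod_nonneg fun j _ => pow_nonneg (hμ j).le _
  rcases le_total 1 (relError d k γ) with hL | hL
  · obtain ⟨N, h1, h2⟩ := coveringNumber_le_of_shells hμ hk hε hhead htail hd hγ
    refine ⟨N, h1, h2.trans ?_⟩
    gcongr
    linarith
  · obtain ⟨N, h1, h2⟩ := coveringNumber_le_of_blocks hμ hk hε hhead htail hd hγ
    refine ⟨N, h1, h2.trans ?_⟩
    gcongr
    have h3 : (1024 : ℝ) ^ relError d k γ ≤ 1 + relError d k γ * 1023 := by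
      have := rpow_one_add_le_one_add_mul_self (s := 1023) (by norm_num) hL0 hL
      norm_num at this ⊢
      exact this
    calc _ ≤ (1 + relError d k γ * 1023) * (1 + relError d k γ) := by gcongr
      _ ≤ _ := by nlinarith

end Rates

/-! ### Assembly of the upper and lower bounds. -/

theorem mainTheorem4 :
    ∃ (C : ℝ) (κ : ℕ → (ℕ → ℕ) → ℝ → ℝ), 0 < C ∧
      (∀ (k : ℕ) (d : ℕ → ℕ) (γ : ℝ), 1 ≤ k → (∀ j < k, 9 ≤ d j) → 1 ≤ γ →
        |κ k d γ - 1| ≤ C * (γ * (k : ℝ) * Real.logb 2 (dimBar d k : ℝ) / (dimBar d k : ℝ))) ∧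
      ∀ (d : ℕ → ℕ) (μ : ℕ → ℝ), (∀ n, 1 ≤ d n) → (∀ n, 0 < μ n) → Antitone μ →
        ∀ (k : ℕ) (ε γ : ℝ), 1 ≤ k → 0 < ε → μ k ≤ ε → ε < μ (k - 1) →
          (∀ j < k, 9 ≤ d j) → 1 ≤ γ →
          mixedCoveringNumber d μ (epsGamma d k γ ε) ≠ ⊤ ∧
          ((mixedCoveringNumber d μ (epsGamma d k γ ε)).toNat : ℝ) ^ (1 / (dimBar d k : ℝ)) *
              epsGamma d k γ ε ≤ κ k d γ * semiAxisMean d μ k ∧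
          semiAxisMean d μ k ≤
            ((mixedCoveringNumber d μ (epsGamma d k γ ε)).toNat : ℝ) ^ (1 / (dimBar d k : ℝ)) *
              epsGamma d k γ ε := by
  refine ⟨2048, fun k d γ => 1 + 2048 * relError d k γ, by norm_num, ?_, ?_⟩
  · intro k d γ hk hd hγ
    rw [add_sub_cancel_left, abs_of_nonneg (mul_nonneg (by norm_num) (relError_nonneg hk hd hγ))]
    exact le_rfl
  · intro d μ _ hμ hanti k ε γ hk hε hkε hεk hd hγ
    have hhead : ∀ j < k, ε < μ j := fun j hj => hεk.trans_le (hanti (by omega))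
    have htail : ∀ j, k ≤ j → μ j ≤ ε := fun j hj => (hanti hj).trans hkε
    have hD : dimBar d k ≠ 0 := by
      have := nine_mul_le_dimBar hd
      omega
    have hρ : 0 ≤ epsGamma d k γ ε := by unfold epsGamma; positivity
    have hM := semiAxisMean_nonneg (d := d) hμ k
    obtain ⟨N, hN, hbound⟩ := coveringNumber_upper_bound hμ hk hε hhead htail hd hγ
    have hfin : mixedCoveringNumber d μ (epsGamma d k γ ε) ≠ ⊤ :=
      ne_top_of_le_ne_top (ENat.natCast_ne_top N) hN
    have hL0 := relError_nonneg hk hd hγ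
    refine ⟨hfin, ?_, ?_⟩
    -- Both inequalities are compared after raising to the power `D`, where the root and the
    -- geometric mean become integer powers.
    · refine (pow_le_pow_iff_left₀ (by positivity) (by positivity) hD).1 ?_
      rw [rpow_one_div_mul_pow (by positivity) hD, mul_pow, semiAxisMean_pow hμ hD]
      refine le_trans (mul_le_mul_of_nonneg_right ?_ (by positivity)) hbound
      exact_mod_cast ENat.toNat_le_of_le_natCast hN
    · refine (pow_le_pow_iff_left₀ hM (by positivity) hD).1 ?_
      rw [rpow_one_div_mul_pow (by positivity) hD, semiAxisMean_pow hμ hD]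
      have := prod_semiAxes_le_coveringNumber hμ k hρ hfin
      rwa [prod_headIndex, card_headIndex] at this
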